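/- Let $k$ be a commutative ring; all algebras are commutative $k$-algebras. A simplicial algebra $\mathbf F$ is called free if there are sets $S_m\subseteq F_{m}$ ($m\ge 1$) of indeterminates, with $d_i b=0$ for all $b\in S_m$ and $i<m$, such that for every $n$ the algebra $F_n$ is the polynomial algebra over $F_0$ (embedded by the iterated degeneracy) on the elements $\theta^*b$, where $m\ge 1$, $b\in S_m$ and $\theta:[n]\to[m]$ is a monotone surjection. The $1$-skeleton of $\mathbf F$ is the value at the $1$-truncation of $\mathbf F$ of the left adjoint of the truncation functor. Let $\mathbf E=\mathbf E^{(1)}$ be the $1$-skeleton of a free simplicial algebra, let $d_i^1:E_1\to E_0$ ($i=0,1$) be its faces, and let $NE_n=\bigcap_{i<n}\operatorname{Ker} d_i^n$ be its Moore complex with $\partial_n$ the restriction of $d_n^n$. Let $E_1$ act on $NE_2/\partial_3NE_3$ through $s_1$, and regard the ideals $\operatorname{Ker}d_0^1$ and $\operatorname{Ker}d_1^1$ of $E_1$ as crossed $E_1$-modules. For crossed $R$-modules $\mu:M\to R$, $\nu:N\to R$, let $M\otimes_R N$ denote the (non-unital) commutative $R$-algebra generated by symbols $m\otimes n$ subject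 to $r(m\otimes n)=rm\otimes n=m\otimes rn$, biadditivity, and $(m\otimes n)(m'\otimes n')=mm'\otimes nn'$; it has the maps $\lambda:M\otimes_R N\to M$, $m\otimes n\mapsto \nu(n)m$, and $\lambda':M\otimes_R N\to N$, $m\otimes n\mapsto\mu(m)n$. For $y\in\operatorname{Ker}d_0^1$ put $\bar y=y-s_0d_1y\in\operatorname{Ker}d_1^1$; the map $y\mapsto\bar y$ is a bijection $\operatorname{Ker}d_0^1\to\operatorname{Ker}d_1^1$. Then there is an isomorphism of $E_1$-algebras $$\operatorname{Ker}d_1^1\otimes_{E_1}\operatorname{Ker}d_0^1\;\cong\; NE_2/\partial_3NE_3$$ under which $\bar y\otimes x$ corresponds to $s_1x(s_1y-s_0y)+\partial_3NE_3$ for all $x,y\in\operatorname{Ker}d_0^1$, and likewise an isomorphism of $E_1$-algebras $\operatorname{Ker}d_0^1\otimes_{E_1}\operatorname{Ker}d_1^1\cong NE_2/\partial_3NE_3$ under which $x\otimes\bar y$ corresponds to $s_1x(s_1y-s_0y)+\partial_3NE_3$. Under both isomorphisms the maps $NE_2/\partial_3NE_3\to\operatorname{Ker}d_0^1$ and $NE_2/\partial_3NE_3\to\operatorname{Ker}d_1^1$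 induced by $d_2$ correspond to the maps $\lambda,\lambda'$ from the tensor product to the respective factors. -/

import Mathlib

open CategoryTheory
open scoped Simplicial TensorProduct

universe u v

noncomputable section

/-! ### Crossed modules of commutative algebras and their tensor product -/

/-- A crossed module `∂ : C → R` of commutative algebras: `C` is a (not necessarily unital)
commutative `R`-algebra, the action of `R` being the scalar multiplication. -/
structure CrossedModule (R C : Type*) [CommRing R] [NonUnitalCommRing C] [Module R C]
    [IsScalarTower R C C] [SMulCommClass R C C] where
  /-- the boundary morphism -/
  bd : C →ₙ+* R
  bd_smul : ∀ (r : R) (c : C), bd (r • c) = r * bd c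
  peiffer : ∀ c c' : C, bd c • c' = c * c'

namespace CrossedModule

/-- An ideal, with its inclusion and the action by multiplication, is a crossed module. -/
def ofIdeal {R : Type*} [CommRing R] (I : Ideal R) : CrossedModule R I where
  bd := { toFun := fun x => (x : R)
          map_mul' := fun _ _ => rfl
          map_zero' := rfl
          map_add' := fun _ _ => rfl }
  bd_smul _ _ := rfl
  peiffer _ _ := rfl

section Tensor

variable {R M N : Type*} [CommRing R]
  [NonUnitalCommRing M] [Module R M] [IsScalarTower R M M] [SMulCommClass R M M]
  [NonUnitalCommRing N] [Module R N] [IsScalarTower R N N] [SMulCommClass R N N]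

/-- The tensor product of two crossed `R`-modules `μ : M → R` and `ν : N → R`: the `R`-algebra
generated by symbols `m ⊗ n`, subject to `r (m ⊗ n) = (r m) ⊗ n = m ⊗ (r n)`, biadditivity and
`(m ⊗ n) (m' ⊗ n') = (m m') ⊗ (n n')`. That this is the algebra with this presentation is
`CrossedModule.tensor_presentation`. -/
abbrev Tensor (_ : CrossedModule R M) (_ : CrossedModule R N) : Type _ := M ⊗[R] N

/-- The morphism `λ : M ⊗ N → M`, `m ⊗ n ↦ ν(n) m`. -/
def tensorFst (X : CrossedModule R M) (Y : CrossedModule R N) : X.Tensor Y →ₗ[R] M :=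
  TensorProduct.lift (LinearMap.mk₂ R (fun m n => Y.bd n • m)
    (fun m m' n => smul_add _ _ _)
    (fun r m n => smul_comm _ _ _)
    (fun m n n' => by rw [map_add, add_smul])
    (fun r m n => by rw [Y.bd_smul, mul_smul]))

/-- The morphism `λ' : M ⊗ N → N`, `m ⊗ n ↦ μ(m) n`. -/
def tensorSnd (X : CrossedModule R M) (Y : CrossedModule R N) : X.Tensor Y →ₗ[R] N :=
  TensorProduct.lift (LinearMap.mk₂ R (fun m n => X.bd m • n)
    (fun m m' n => by rw [map_add, add_smul])
    (fun r m n => by rw [X.bd_smul, mul_smul])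
    (fun m n n' => smul_add _ _ _)
    (fun r m n => smul_comm _ _ _))

/-- The tensor product has the stated presentation: a map `h` on the symbols `m ⊗ n` with values in
a commutative `R`-algebra extends to an algebra morphism, in a unique way, as soon as it respects
the defining relations. -/
theorem tensor_presentation (X : CrossedModule R M) (Y : CrossedModule R N)
    {A : Type*} [NonUnitalCommRing A] [Module R A] [IsScalarTower R A A] [SMulCommClass R A A]
    (h : M → N → A)
    (h_smul_left : ∀ (r : R) m n, h (r • m) n = r • h m n)
    (h_smul_right : ∀ (r : R) m n, h m (r • n) = r • h m n)
    (h_add_left : ∀ m m' n, h (m + m') n = h m n + h m' n)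
    (h_add_right : ∀ m n n', h m (n + n') = h m n + h m n')
    (h_mul : ∀ m m' n n', h m n * h m' n' = h (m * m') (n * n')) :
    ∃! φ : X.Tensor Y →ₙₐ[R] A, ∀ m n, φ (m ⊗ₜ[R] n) = h m n := by
  let f : M ⊗[R] N →ₗ[R] A := TensorProduct.lift
    (LinearMap.mk₂ R h h_add_left h_smul_left h_add_right h_smul_right)
  have hf : ∀ m n, f (m ⊗ₜ[R] n) = h m n := fun m n => by simp [f]
  refine ⟨{ toFun := f, map_smul' := fun r t => map_smul f r t, map_zero' := map_zero f,
            map_add' := map_add f, map_mul' := ?_ }, hf, ?_⟩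
  · intro s t
    induction s using TensorProduct.induction_on with
    | zero => simp
    | add s s' hs hs' => rw [add_mul, map_add, hs, hs', map_add, add_mul]
    | tmul m n =>
      induction t using TensorProduct.induction_on with
      | zero => simp
      | add t t' ht ht' => rw [mul_add, map_add, ht, ht', map_add, mul_add]
      | tmul m' n' => rw [Algebra.TensorProduct.tmul_mul_tmul, hf, hf, hf, h_mul]
  · intro ψ hψ
    ext t
    change ψ t = f t
    induction t using TensorProduct.induction_on with
    | zero => simp
    | add s s' hs hs' => rw [map_add, map_add, hs, hs']
    | tmul m n => rw [hψ, hf]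

end Tensor

end CrossedModule

/-! ### Simplicial commutative algebras -/

/-- Simplicial commutative `k`-algebras. -/
abbrev SimpAlg (k : Type u) [CommRing k] := SimplicialObject (CommAlgCat.{v} k)

namespace SimpAlg

variable {k : Type u} [CommRing k]

/-- The face morphism `d_i : E_{n+1} → E_n`. -/
abbrev d (E : SimpAlg.{u, v} k) {n : ℕ} (i : Fin (n + 2)) : E _⦋n + 1⦌ →ₐ[k] E _⦋n⦌ :=
  (E.δ i).hom

/-- The degeneracy morphism `s_i : E_n → E_{n+1}`. -/
abbrev s (E : SimpAlg.{u, v} k) {n : ℕ} (i : Fin (n + 1)) : E _⦋n⦌ →ₐ[k] E _⦋n + 1⦌ :=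
  (E.σ i).hom

/-! #### Free simplicial algebras and skeletons -/

/-- The degenerate copies in dimension `n` of the indeterminates `S m` of dimension `m + 1`: one for
every indeterminate `b` and every surjective monotone map `⦋n⦌ → ⦋m + 1⦌`. -/
abbrev FreeIndex (F : SimpAlg.{u, v} k) (S : ∀ m : ℕ, Set (F _⦋m + 1⦌)) (n : ℕ) : Type v :=
  Σ m : ℕ, {θ : ⦋n⦌ ⟶ ⦋m + 1⦌ // Epi θ} × S m

/-- The canonical morphism from the polynomial algebra over `F_0` on the degenerate copies of the
indeterminates to `F_n`; the algebra `F_0` maps to `F_n` by the iterated degeneracy. -/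
def freeMap (F : SimpAlg.{u, v} k) (S : ∀ m : ℕ, Set (F _⦋m + 1⦌)) (n : ℕ) :
    MvPolynomial (F.FreeIndex S n) (F _⦋0⦌) →+* F _⦋n⦌ :=
  MvPolynomial.eval₂Hom ((F.map (SimplexCategory.const ⦋n⦌ ⦋0⦌ 0).op).hom : F _⦋0⦌ →+* F _⦋n⦌)
    (fun j => (F.map j.2.1.1.op).hom j.2.2.1)

/-- A simplicial algebra is free (obtained from the constant simplicial algebra on `F_0` by the
step-by-step construction) if there are sets of indeterminates `S m ⊆ F_{m+1}`, all of whose faces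
except the last one vanish, such that every `F_n` is the polynomial algebra over `F_0` on the
degenerate copies of these indeterminates. -/
def IsFree (F : SimpAlg.{u, v} k) : Prop :=
  ∃ S : ∀ m : ℕ, Set (F _⦋m + 1⦌),
    (∀ m, ∀ b ∈ S m, ∀ i : Fin (m + 1), F.d i.castSucc b = 0) ∧
    ∀ n, Function.Bijective (F.freeMap S n)

/-- `E` is `n`-skeletal: morphisms from `E` to any simplicial algebra are the same as morphisms of
the `n`-truncations, i.e. `E` is the value at its own `n`-truncation of the left adjoint of the
truncation functor. -/
def IsSkeletal (n : ℕ) (E : SimpAlg.{u, v} k) : Prop :=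
  ∀ Y : SimpAlg.{u, v} k, Function.Bijective
    (fun g : E ⟶ Y => (SimplicialObject.truncation n).map g)

/-- `ι : E → F` exhibits `E` as the `n`-skeleton of `F`: `E` is `n`-skeletal and `ι` is an
isomorphism on `n`-truncations. -/
structure IsSkeleton (n : ℕ) {E F : SimpAlg.{u, v} k} (ι : E ⟶ F) : Prop where
  isIso_truncation : IsIso ((SimplicialObject.truncation n).map ι)
  skeletal : E.IsSkeletal n

/-! #### The Moore complex and its crossed square -/

/-- The Moore complex `NE_n = ⋂_{i < n} Ker d_i`, as an ideal of `E_n`. -/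
def moore (E : SimpAlg.{u, v} k) (n : ℕ) : Ideal (E _⦋n⦌) :=
  match n with
  | 0 => ⊤
  | n + 1 => ⨅ i : Fin (n + 1), RingHom.ker (E.d i.castSucc)

/-- The boundaries `∂_{n+1} (NE_{n+1}) = d_{n+1} (NE_{n+1})`, which form a sub-`E_n`-module
(that is, an ideal) of `NE_n`. -/
def boundaries (E : SimpAlg.{u, v} k) (n : ℕ) : Submodule (E _⦋n⦌) (E.moore n) where
  carrier := {z | ∃ w ∈ E.moore (n + 1), E.d (Fin.last (n + 1)) w = z}
  zero_mem' := ⟨0, zero_mem _, map_zero _⟩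
  add_mem' := by
    rintro a b ⟨w, hw, hwa⟩ ⟨w', hw', hwb⟩
    exact ⟨w + w', add_mem hw hw', by rw [map_add, hwa, hwb]; rfl⟩
  smul_mem' := by
    rintro e a ⟨w, hw, hwa⟩
    refine ⟨E.s (Fin.last n) e * w, Ideal.mul_mem_left _ _ hw, ?_⟩
    have h : E.d (Fin.last (n + 1)) (E.s (Fin.last n) e) = e := by
      have := E.δ_comp_σ_succ (i := Fin.last n)
      exact congrArg (fun f => f.hom e) this
    rw [map_mul, h, hwa]
    rfl

/-- The top corner `NE_2 / ∂_3 (NE_3)` of the crossed square of `E`. -/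
def TopCorner (E : SimpAlg.{u, v} k) : Type v := E.moore 2 ⧸ E.boundaries 2

namespace TopCorner

variable (E : SimpAlg.{u, v} k)

instance : AddCommGroup E.TopCorner := inferInstanceAs (AddCommGroup (E.moore 2 ⧸ E.boundaries 2))

/-- The class in `NE_2 / ∂_3 (NE_3)` of an element of `NE_2`. -/
def mk : E.moore 2 →+ E.TopCorner := (E.boundaries 2).mkQ.toAddMonoidHom

variable {E}

theorem mk_surjective : Function.Surjective (mk E) := Submodule.Quotient.mk_surjective _

theorem mk_eq_zero {z : E.moore 2} : mk E z = 0 ↔ z ∈ E.boundaries 2 :=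
  Submodule.Quotient.mk_eq_zero _

theorem mk_eq {z z' : E.moore 2} : mk E z = mk E z' ↔ z - z' ∈ E.boundaries 2 :=
  Submodule.Quotient.eq _

/-- The multiplication of `NE_2 / ∂_3 (NE_3)` is induced by that of `NE_2`. -/
instance : Mul E.TopCorner where
  mul a b := Quotient.liftOn₂' a b (fun z w => mk E (z * w)) (by
    intro z w z' w' hz hw
    have hz' : z - z' ∈ E.boundaries 2 := (Submodule.quotientRel_def _).1 hz
    have hw' : w - w' ∈ E.boundaries 2 := (Submodule.quotientRel_def _).1 hw
    rw [mk_eq]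
    have h : z * w - z' * w' = (w : E _⦋2⦌) • (z - z') + (z' : E _⦋2⦌) • (w - w') := by
      ext
      simp only [Submodule.coe_sub, Submodule.coe_add, Submodule.coe_smul, smul_eq_mul,
        MulMemClass.coe_mul]
      ring
    rw [h]
    exact add_mem (Submodule.smul_mem _ _ hz') (Submodule.smul_mem _ _ hw'))

theorem mk_mul (z w : E.moore 2) : mk E (z * w) = mk E z * mk E w := rfl

instance : NonUnitalCommRing E.TopCorner where
  left_distrib a b c := by
    obtain ⟨a, rfl⟩ := mk_surjective a
    obtain ⟨b, rfl⟩ := mk_surjective b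
    obtain ⟨c, rfl⟩ := mk_surjective c
    simp only [← mk_mul, ← map_add, mul_add]
  right_distrib a b c := by
    obtain ⟨a, rfl⟩ := mk_surjective a
    obtain ⟨b, rfl⟩ := mk_surjective b
    obtain ⟨c, rfl⟩ := mk_surjective c
    simp only [← mk_mul, ← map_add, add_mul]
  zero_mul a := by
    obtain ⟨a, rfl⟩ := mk_surjective a
    rw [← map_zero (mk E), ← mk_mul, zero_mul]
  mul_zero a := by
    obtain ⟨a, rfl⟩ := mk_surjective a
    rw [← map_zero (mk E), ← mk_mul, mul_zero]
  mul_assoc a b c := by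
    obtain ⟨a, rfl⟩ := mk_surjective a
    obtain ⟨b, rfl⟩ := mk_surjective b
    obtain ⟨c, rfl⟩ := mk_surjective c
    simp only [← mk_mul, mul_assoc]
  mul_comm a b := by
    obtain ⟨a, rfl⟩ := mk_surjective a
    obtain ⟨b, rfl⟩ := mk_surjective b
    rw [← mk_mul, ← mk_mul, mul_comm]

/-- The action of `E_1` on `NE_2 / ∂_3 (NE_3)`: an element `e` acts as multiplication by `s_1 e`. -/
instance : Module (E _⦋1⦌) E.TopCorner :=
  letI : Module (E _⦋2⦌) E.TopCorner :=
    inferInstanceAs (Module (E _⦋2⦌) (E.moore 2 ⧸ E.boundaries 2))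
  Module.compHom E.TopCorner (E.s (1 : Fin 2) : E _⦋1⦌ →+* E _⦋2⦌)

theorem smul_mk (e : E _⦋1⦌) (z : E.moore 2) :
    e • mk E z = mk E ((E.s (1 : Fin 2) e : E _⦋2⦌) • z) := rfl

end TopCorner

variable (E : SimpAlg.{u, v} k)

/-- The ideal `Ker (d_i : E_1 → E_0)` of `E_1`. -/
abbrev kerD (i : Fin 2) : Ideal (E _⦋1⦌) := RingHom.ker (E.d i)

/-- The crossed module given by the inclusion of `Ker (d_i : E_1 → E_0)` in `E_1`. -/
def kerCM (i : Fin 2) : CrossedModule (E _⦋1⦌) (E.kerD i) := CrossedModule.ofIdeal _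

variable {E}

theorem d_d {n : ℕ} {i j : Fin (n + 2)} (h : i ≤ j) (x : E _⦋n + 2⦌) :
    E.d i (E.d j.succ x) = E.d j (E.d i.castSucc x) :=
  congrArg (fun f => f.hom x) (E.δ_comp_δ h)

theorem mem_moore_two {z : E _⦋2⦌} :
    z ∈ E.moore 2 ↔ E.d (0 : Fin 3) z = 0 ∧ E.d (1 : Fin 3) z = 0 := by
  change z ∈ (⨅ i : Fin 2, RingHom.ker (E.d i.castSucc) : Ideal (E _⦋2⦌)) ↔ _
  simp only [Ideal.mem_iInf, Fin.forall_fin_two, RingHom.mem_ker]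
  rfl

theorem mem_moore_three {w : E _⦋3⦌} (hw : w ∈ E.moore 3) (i : Fin 3) :
    E.d i.castSucc w = 0 := by
  change w ∈ (⨅ i : Fin 3, RingHom.ker (E.d i.castSucc) : Ideal (E _⦋3⦌)) at hw
  exact (Ideal.mem_iInf.1 hw) i

theorem d_two_mem {z : E _⦋2⦌} (hz : z ∈ E.moore 2) (i : Fin 2) : E.d (2 : Fin 3) z ∈ E.kerD i := by
  rw [mem_moore_two] at hz
  rw [RingHom.mem_ker]
  have h := d_d (E := E) (i := i) (j := 1) (Fin.le_last i) z
  change E.d i (E.d (2 : Fin 3) z) = _ at h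
  rw [h]
  have hi : E.d i.castSucc z = 0 := by
    fin_cases i
    · exact hz.1
    · exact hz.2
  rw [hi, map_zero]

variable (E)

/-- The morphisms `NE_2 / ∂_3 (NE_3) → Ker d_i` (for `i = 0, 1`) of the crossed square of `E`; both
are induced by `d_2`. -/
def topBd (i : Fin 2) : E.TopCorner →+ E.kerD i :=
  QuotientAddGroup.lift (E.boundaries 2).toAddSubgroup
    { toFun := fun z => ⟨E.d (2 : Fin 3) z.1, d_two_mem z.2 i⟩
      map_zero' := Subtype.ext (map_zero _)
      map_add' := fun z z' => Subtype.ext (map_add _ _ _) }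
    (by
      rintro z ⟨w, hw, hwz⟩
      refine Subtype.ext ?_
      change E.d (2 : Fin 3) z.1 = 0
      rw [← hwz]
      change E.d (2 : Fin 3) (E.d (2 : Fin 3).succ w) = 0
      rw [d_d le_rfl, mem_moore_three hw 2, map_zero])

theorem topBd_mk (i : Fin 2) (z : E.moore 2) :
    (E.topBd i (TopCorner.mk E z) : E _⦋1⦌) = E.d (2 : Fin 3) z.1 := rfl

/-- The natural bijection `y ↦ ȳ = y - s_0 d_1 y` from `Ker d_0` to `Ker d_1`. -/
def bar (y : E.kerD 0) : E.kerD 1 :=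
  ⟨y - E.s (0 : Fin 1) (E.d (1 : Fin 2) y), by
    have h : E.d (1 : Fin 2) (E.s (0 : Fin 1) (E.d (1 : Fin 2) (y : E _⦋1⦌)))
        = E.d (1 : Fin 2) (y : E _⦋1⦌) :=
      congrArg (fun f => f.hom (E.d (1 : Fin 2) (y : E _⦋1⦌))) (E.δ_comp_σ_succ (i := (0 : Fin 1)))
    rw [RingHom.mem_ker, map_sub, h, sub_self]⟩

/-- `y ↦ ȳ` is a bijection; its inverse is `z ↦ z - s_0 d_0 z`. -/
theorem bar_bijective : Function.Bijective E.bar := by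
  have h0 : ∀ r : E _⦋0⦌, E.d (0 : Fin 2) (E.s (0 : Fin 1) r) = r := fun r =>
    congrArg (fun f => f.hom r) (E.δ_comp_σ_self (i := (0 : Fin 1)))
  have h1 : ∀ r : E _⦋0⦌, E.d (1 : Fin 2) (E.s (0 : Fin 1) r) = r := fun r =>
    congrArg (fun f => f.hom r) (E.δ_comp_σ_succ (i := (0 : Fin 1)))
  refine Function.bijective_iff_has_inverse.2
    ⟨fun z => ⟨z - E.s (0 : Fin 1) (E.d (0 : Fin 2) z), ?_⟩, fun y => ?_, fun z => ?_⟩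
  · rw [RingHom.mem_ker, map_sub, h0, sub_self]
  · have hy : E.d (0 : Fin 2) (y : E _⦋1⦌) = 0 := y.2
    refine Subtype.ext ?_
    simp only [bar, map_sub, h0, hy]
    simp
  · have hz : E.d (1 : Fin 2) (z : E _⦋1⦌) = 0 := z.2
    refine Subtype.ext ?_
    simp only [bar, map_sub, h1, hz]
    simp

/-- The element `s_1 x (s_1 y - s_0 y)` of `NE_2`, for `x, y` in `Ker d_0`. -/
def hElt (x y : E.kerD 0) : E.moore 2 :=
  ⟨E.s (1 : Fin 2) x * (E.s (1 : Fin 2) y - E.s (0 : Fin 2) y), by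
    have hx : E.d (0 : Fin 2) (x : E _⦋1⦌) = 0 := x.2
    have h0 : E.d (0 : Fin 3) (E.s (1 : Fin 2) (x : E _⦋1⦌))
        = E.s (0 : Fin 1) (E.d (0 : Fin 2) (x : E _⦋1⦌)) :=
      congrArg (fun f => f.hom (x : E _⦋1⦌))
        (E.δ_comp_σ_of_le (i := (0 : Fin 2)) (j := (0 : Fin 1)) (by simp))
    have h1 : E.d (1 : Fin 3) (E.s (1 : Fin 2) (y : E _⦋1⦌)) = y :=
      congrArg (fun f => f.hom (y : E _⦋1⦌)) (E.δ_comp_σ_self (i := (1 : Fin 2)))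
    have h2 : E.d (1 : Fin 3) (E.s (0 : Fin 2) (y : E _⦋1⦌)) = y :=
      congrArg (fun f => f.hom (y : E _⦋1⦌)) (E.δ_comp_σ_succ (i := (0 : Fin 2)))
    rw [mem_moore_two]
    refine ⟨?_, ?_⟩
    · rw [map_mul, h0, hx, map_zero, zero_mul]
    · rw [map_mul, map_sub, h1, h2, sub_self, mul_zero]⟩

end SimpAlg

end

/-! ### Action of simplicial operators on elements. -/

namespace SimpAlg

variable {k : Type u} [CommRing k] (E : SimpAlg.{u, v} k)

/-! A `1`-skeletal `E` is generated by `E_1` under simplicial operators, and comparison with the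
polynomial structure of `F` shows that there are no further relations: each `E_{n+1}` is a
polynomial algebra over `E_n`, embedded by the last degeneracy `s_n`
(`IsSkeleton.exists_isOneFree`). On `E_{n+2}` the faces `d_0, …, d_n` act only on coefficients,
while `d_{n+1}` retracts `s_{n+1}`. Write `I` for the extension of `Ker d_0 ⊆ E_1` along `s_1` and
`K` for the kernel of `d_1 : E_2 → E_1`. Then `NE_2 = I K` (the nontrivial inclusion is
`moore_two_le`), and since `E_2` is flat over `E_1` the multiplication `I ⊗ K → E_2` is injective
(`mulMap_injective`). The same argument one dimension higher gives `∂_3 NE_3 ⊆ NE_2 · Ker d_2`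
(`boundary_mem`).

In the other direction, explicit elements of `NE_3` show, for any simplicial algebra, that the class
of `X T` with `d_0 X = 0`, `d_1 T = 0` depends only on `d_2 X` and `d_2 T` (`mkMul_congr`). The
pairing `(z, x) ↦ s_1 x (s_1 z - s_0 z)` is therefore bilinear and multiplicative modulo boundaries,
and it gives the comparison map `tensorToTop`. It is onto because `X T` has the class of the pairing
of `d_2 T` with `d_2 X`. It is injective because `X ⊗ T ↦ d_2 T ⊗ d_2 X` is well defined on `I ⊗ K`,
which is `NE_2`, and vanishes on `NE_2 · Ker d_2`, hence on boundaries. The second isomorphism is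
the first one after exchanging the tensor factors. -/

theorem map_map {X Y Z : SimplexCategory} (f : X ⟶ Y) (g : Y ⟶ Z) (e : E.obj (.op Z)) :
    (E.map f.op).hom ((E.map g.op).hom e) = (E.map (f ≫ g).op).hom e := by
  rw [op_comp, E.map_comp, CommAlgCat.hom_comp, AlgHom.comp_apply]

theorem map_id_apply {X : SimplexCategory} (e : E.obj (.op X)) :
    (E.map (𝟙 X : X ⟶ X).op).hom e = e := by
  rw [op_id, E.map_id, CommAlgCat.hom_id, AlgHom.id_apply]

theorem app_map {E F : SimpAlg.{u, v} k} (f : E ⟶ F) {X Y : SimplexCategory} (g : X ⟶ Y)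
    (e : E.obj (.op Y)) :
    (f.app (.op X)).hom ((E.map g.op).hom e) = (F.map g.op).hom ((f.app (.op Y)).hom e) :=
  congrArg (fun φ => φ.hom e) (f.naturality g.op)

/-! #### The simplicial subalgebra generated in dimension one -/

/-- The subalgebra of `E_X` generated by the images of `E_1` under all simplicial operators. -/
def oneGenerated (X : SimplexCategoryᵒᵖ) : Subalgebra k (E.obj X) :=
  Algebra.adjoin k {y | ∃ (α : X.unop ⟶ ⦋1⦌) (e : E _⦋1⦌), (E.map α.op).hom e = y}

theorem map_mem_oneGenerated {X Y : SimplexCategoryᵒᵖ} (f : X ⟶ Y) {e : E.obj X}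
    (he : e ∈ E.oneGenerated X) : (E.map f).hom e ∈ E.oneGenerated Y := by
  have : E.oneGenerated X ≤ (E.oneGenerated Y).comap (E.map f).hom := by
    refine Algebra.adjoin_le ?_
    rintro _ ⟨α, e, rfl⟩
    exact Algebra.subset_adjoin ⟨f.unop ≫ α, e, (E.map_map f.unop α e).symm⟩
  exact this he

theorem oneGenerated_eq_top_of_len_le {X : SimplexCategoryᵒᵖ} (hX : X.unop.len ≤ 1) :
    E.oneGenerated X = ⊤ := by
  -- An object of dimension at most one is a retract of `⦋1⦌`, so every `e` is the image under `α`
  -- of an element of `E_1`.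
  obtain ⟨α, ρ, h⟩ : ∃ (α : X.unop ⟶ ⦋1⦌) (ρ : ⦋1⦌ ⟶ X.unop), α ≫ ρ = 𝟙 _ := by
    induction X using Opposite.rec with | _ X =>
    induction X using SimplexCategory.rec with | _ n =>
    change n ≤ 1 at hX
    interval_cases n
    · exact ⟨SimplexCategory.δ 0, SimplexCategory.σ 0, SimplexCategory.δ_comp_σ_self' rfl⟩
    · exact ⟨𝟙 _, 𝟙 _, Category.id_comp _⟩
  refine eq_top_iff.2 fun e _ => Algebra.subset_adjoin ⟨α, (E.map ρ.op).hom e, ?_⟩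
  have := E.map_map α ρ e
  rw [h] at this
  exact this.trans (E.map_id_apply e)

/-- The simplicial subalgebra generated by `E_1`. -/
def oneGeneratedObj : SimpAlg.{u, v} k where
  obj X := CommAlgCat.of k (E.oneGenerated X)
  map f := CommAlgCat.ofHom (((E.map f).hom.comp (E.oneGenerated _).val).codRestrict _
    fun e => E.map_mem_oneGenerated f e.2)
  map_id X := by
    exact CommAlgCat.hom_ext (AlgHom.ext fun e => Subtype.ext (E.map_id_apply e.1))
  map_comp f g := by
    exact CommAlgCat.hom_ext (AlgHom.ext fun e =>
      Subtype.ext (E.map_map g.unop f.unop e.1).symm)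

/-- The inclusion of the simplicial subalgebra generated by `E_1`. -/
def oneGeneratedIncl : E.oneGeneratedObj ⟶ E where
  app X := CommAlgCat.ofHom (E.oneGenerated X).val
  naturality _ _ _ := rfl

/-- The truncation of `E` maps to that of the simplicial subalgebra generated by `E_1`. -/
def truncationToOneGenerated :
    (SimplicialObject.truncation 1).obj E ⟶
      (SimplicialObject.truncation 1).obj E.oneGeneratedObj where
  app X := CommAlgCat.ofHom ((AlgHom.id k _).codRestrict
    (E.oneGenerated (.op X.unop.obj))
    fun e => by rw [E.oneGenerated_eq_top_of_len_le X.unop.property]; exact Algebra.mem_top)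
  naturality _ _ _ := rfl

variable {E}

/-- A `1`-skeletal simplicial algebra is generated by its part of dimension one. -/
theorem IsSkeletal.oneGenerated_eq_top (hE : E.IsSkeletal 1) (X : SimplexCategoryᵒᵖ) :
    E.oneGenerated X = ⊤ := by
  -- The subalgebra has the same `1`-truncation as `E`, so skeletality extends the identification to
  -- `g : E ⟶ E.oneGeneratedObj`. Its composite with the inclusion is the identity on truncations,
  -- hence the identity.
  obtain ⟨g, hg⟩ := (hE E.oneGeneratedObj).2 E.truncationToOneGenerated
  have h : g ≫ E.oneGeneratedIncl = 𝟙 E := by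
    refine (hE E).1 ?_
    change (SimplicialObject.truncation 1).map (g ≫ E.oneGeneratedIncl) = _
    rw [Functor.map_comp]
    change (SimplicialObject.truncation 1).map g ≫ _ = _
    change (SimplicialObject.truncation 1).map g = _ at hg
    rw [hg]
    rfl
  refine eq_top_iff.2 fun e _ => ?_
  have he : ((g.app X).hom e).1 = e :=
    congrArg (fun φ : E ⟶ E => (φ.app X).hom e) h
  rw [← he]
  exact ((g.app X).hom e).2

theorem IsSkeleton.app_bijective {F : SimpAlg.{u, v} k} {n : ℕ} {ι : E ⟶ F}
    (hι : IsSkeleton n ι) (m : ℕ) (hm : m ≤ n) :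
    Function.Bijective (ι.app (.op ⦋m⦌)).hom := by
  have := hι.isIso_truncation
  have h : IsIso (((SimplicialObject.truncation n).map ι).app (.op ⟨⦋m⦌, hm⟩)) := inferInstance
  change IsIso (ι.app (.op ⦋m⦌)) at h
  exact ConcreteCategory.bijective_of_isIso (ι.app (.op ⦋m⦌))

end SimpAlg
/-! #### Polynomial structure of the skeleton -/

/-! ### Monotone maps to `⦋1⦌`. -/

namespace SimplexCategory

/-- The map `⦋n + 1⦌ ⟶ ⦋1⦌` that sends only the last vertex to `1`. -/
def lastCut (n : ℕ) : ⦋n + 1⦌ ⟶ ⦋1⦌ :=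
  mkHom ⟨fun i => if i = Fin.last (n + 1) then 1 else 0, fun i j hij => by
    dsimp only
    split_ifs with h1 h2
    · exact le_rfl
    · exact absurd (Fin.last_le_iff.1 (h1 ▸ hij)) h2
    · exact Fin.zero_le _
    · exact le_rfl⟩

theorem lastCut_apply (n : ℕ) (i : Fin (n + 2)) :
    lastCut n i = if i = Fin.last (n + 1) then 1 else 0 := rfl

theorem δ_comp_lastCut (n : ℕ) (i : Fin (n + 2)) :
    δ i.castSucc ≫ lastCut (n + 1) = lastCut n := by
  ext j : 3
  change (if i.castSucc.succAbove j = Fin.last (n + 2) then (1 : Fin 2) else 0)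
    = if j = Fin.last (n + 1) then 1 else 0
  congr 1
  rw [eq_iff_iff]
  constructor
  · intro h
    by_contra hj
    have := Fin.succAbove_ne_last (a := i.castSucc) (b := j) (by simp [Fin.ext_iff]; omega) hj
    exact this h
  · rintro rfl
    exact Fin.succAbove_ne_last_last (by simp [Fin.ext_iff]; omega)

theorem lastCut_zero : lastCut 0 = 𝟙 _ := by
  ext j : 3
  fin_cases j <;> rfl

instance epi_lastCut (n : ℕ) : Epi (lastCut n) := by
  rw [epi_iff_surjective]
  intro i
  fin_cases i
  · exact ⟨0, rfl⟩
  · exact ⟨Fin.last (n + 1), if_pos rfl⟩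

/-- The degeneracy identifies the last two vertices, which `lastCut` separates. This keeps the new
indeterminates of `E_{n+1}` apart from those degenerated from `E_n`. -/
theorem σ_last_comp_ne_lastCut {n : ℕ} (θ : ⦋n⦌ ⟶ ⦋1⦌) : σ (Fin.last n) ≫ θ ≠ lastCut n := by
  intro h
  have h1 : (σ (Fin.last n) ≫ θ) (Fin.last (n + 1)) = (σ (Fin.last n) ≫ θ) (Fin.last n).castSucc := by
    change θ ((Fin.last n).predAbove (Fin.last (n + 1)))
      = θ ((Fin.last n).predAbove (Fin.last n).castSucc)
    simp
  rw [h, lastCut_apply, lastCut_apply] at h1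
  simp [Fin.ext_iff] at h1

theorem eq_lastCut_or {n : ℕ} (α : ⦋n + 1⦌ ⟶ ⦋1⦌) :
    α = lastCut n ∨ ∃ α' : ⦋n⦌ ⟶ ⦋1⦌, α = σ (Fin.last n) ≫ α' := by
  by_cases h : α (Fin.last (n + 1)) = α (Fin.last n).castSucc
  · refine .inr ⟨δ (Fin.last (n + 1)) ≫ α, ?_⟩
    ext j : 3
    change α j = α ((Fin.last (n + 1)).succAbove ((Fin.last n).predAbove j))
    induction j using Fin.lastCases with
    | last => simpa using h
    | cast j => simp
  · refine .inl ?_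
    have hle : α (Fin.last n).castSucc ≤ α (Fin.last (n + 1)) :=
      α.toOrderHom.monotone (Fin.le_last _)
    obtain ⟨h0, h1⟩ : α (Fin.last n).castSucc = 0 ∧ α (Fin.last (n + 1)) = 1 :=
      (by decide : ∀ a b : Fin 2, a ≤ b → ¬ b = a → a = 0 ∧ b = 1) _ _ hle h
    ext j : 3
    change α j = if j = Fin.last (n + 1) then (1 : Fin 2) else 0
    induction j using Fin.lastCases with
    | last => simpa using h1
    | cast j =>
      have : α j.castSucc ≤ α (Fin.last n).castSucc :=
        α.toOrderHom.monotone (Fin.castSucc_le_castSucc_iff.2 (Fin.le_last _))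
      rw [h0] at this
      rw [if_neg (by simp [Fin.ext_iff]; omega)]
      exact Fin.le_zero_iff.1 this

theorem epi_or_eq_const_comp {n : ℕ} (α : ⦋n⦌ ⟶ ⦋1⦌) :
    Epi α ∨ ∃ γ : ⦋0⦌ ⟶ ⦋1⦌, α = const ⦋n⦌ ⦋0⦌ 0 ≫ γ := by
  by_cases h : ∃ c : Fin 2, ∀ i, α i = c
  · obtain ⟨c, hc⟩ := h
    refine .inr ⟨const ⦋0⦌ ⦋1⦌ c, ?_⟩
    ext j : 3
    exact hc j
  · refine .inl (epi_iff_surjective.2 fun c => ?_)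
    by_contra! hc
    -- If the vertex `c` is missed, the map is constant at the other vertex `1 - c`.
    refine h ⟨1 - c, fun i => ?_⟩
    have := hc i
    change α i ≠ c at this
    generalize (α i : Fin 2) = a at this
    clear hc h
    revert c a
    decide

end SimplexCategory
-- Polynomial generators in every dimension.
namespace SimpAlg

variable {k : Type u} [CommRing k] {E : SimpAlg.{u, v} k}

/-- The map `E_n[B] → E_{n+1}` that is the last degeneracy on coefficients and that sends the
indeterminate `b` to the degenerate copy of `β b ∈ E_1` for `⦋n + 1⦌ = {0 < ⋯ < n} ⊔ {n + 1}`. -/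
def polyMap {B : Type v} (β : B → E _⦋1⦌) (n : ℕ) : MvPolynomial B (E _⦋n⦌) →+* E _⦋n + 1⦌ :=
  MvPolynomial.eval₂Hom (E.s (Fin.last n) : E _⦋n⦌ →+* E _⦋n + 1⦌)
    fun b => (E.map (SimplexCategory.lastCut n).op).hom (β b)

@[simp]
theorem polyMap_C {B : Type v} (β : B → E _⦋1⦌) (n : ℕ) (e : E _⦋n⦌) :
    polyMap β n (MvPolynomial.C e) = E.s (Fin.last n) e := MvPolynomial.eval₂Hom_C _ _ _

@[simp]
theorem polyMap_X {B : Type v} (β : B → E _⦋1⦌) (n : ℕ) (b : B) :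
    polyMap β n (MvPolynomial.X b) = (E.map (SimplexCategory.lastCut n).op).hom (β b) :=
  MvPolynomial.eval₂Hom_X' _ _ _

/-- The map from the polynomial algebra over `E_0` on the degenerate copies in dimension `n` of
the elements `β b ∈ E_1`. -/
def epiMap {B : Type v} (β : B → E _⦋1⦌) (n : ℕ) :
    MvPolynomial ({θ : ⦋n⦌ ⟶ ⦋1⦌ // Epi θ} × B) (E _⦋0⦌) →+* E _⦋n⦌ :=
  MvPolynomial.eval₂Hom ((E.map (SimplexCategory.const ⦋n⦌ ⦋0⦌ 0).op).hom : E _⦋0⦌ →+* E _⦋n⦌)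
    (fun j => (E.map j.1.1.op).hom (β j.2))

@[simp]
theorem epiMap_C {B : Type v} (β : B → E _⦋1⦌) (n : ℕ) (e : E _⦋0⦌) :
    epiMap β n (MvPolynomial.C e) = (E.map (SimplexCategory.const ⦋n⦌ ⦋0⦌ 0).op).hom e :=
  MvPolynomial.eval₂Hom_C _ _ _

@[simp]
theorem epiMap_X {B : Type v} (β : B → E _⦋1⦌) (n : ℕ)
    (j : {θ : ⦋n⦌ ⟶ ⦋1⦌ // Epi θ} × B) :
    epiMap β n (MvPolynomial.X j) = (E.map j.1.1.op).hom (β j.2) :=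
  MvPolynomial.eval₂Hom_X' _ _ _

@[simp]
theorem freeMap_C (F : SimpAlg.{u, v} k) (S : ∀ m : ℕ, Set (F _⦋m + 1⦌)) (n : ℕ) (e : F _⦋0⦌) :
    F.freeMap S n (MvPolynomial.C e) = (F.map (SimplexCategory.const ⦋n⦌ ⦋0⦌ 0).op).hom e :=
  MvPolynomial.eval₂Hom_C _ _ _

@[simp]
theorem freeMap_X (F : SimpAlg.{u, v} k) (S : ∀ m : ℕ, Set (F _⦋m + 1⦌)) (n : ℕ)
    (j : F.FreeIndex S n) :
    F.freeMap S n (MvPolynomial.X j) = (F.map j.2.1.1.op).hom j.2.2.1 :=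
  MvPolynomial.eval₂Hom_X' _ _ _

theorem surjective_of_operators_mem (hE : E.IsSkeletal 1) {n : ℕ} {P : Type*} [CommRing P]
    (f : P →+* E _⦋n⦌) (hk : ∀ c : k, algebraMap k (E _⦋n⦌) c ∈ f.range)
    (hα : ∀ (α : ⦋n⦌ ⟶ ⦋1⦌) (e : E _⦋1⦌), (E.map α.op).hom e ∈ f.range) :
    Function.Surjective f := by
  intro e
  have he : e ∈ E.oneGenerated (.op ⦋n⦌) := by
    rw [hE.oneGenerated_eq_top]; exact Algebra.mem_top
  change e ∈ f.range
  induction he using Algebra.adjoin_induction with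
  | mem x hx =>
    obtain ⟨α, e, rfl⟩ := hx
    exact hα α e
  | algebraMap c => exact hk c
  | add x y _ _ hx hy => exact add_mem hx hy
  | mul x y _ _ hx hy => exact mul_mem hx hy

theorem const_map_const {n m : ℕ} (α : ⦋n⦌ ⟶ ⦋m⦌) (e : E _⦋0⦌) :
    (E.map α.op).hom ((E.map (SimplexCategory.const ⦋m⦌ ⦋0⦌ 0).op).hom e)
      = (E.map (SimplexCategory.const ⦋n⦌ ⦋0⦌ 0).op).hom e :=
  E.map_map α _ e

theorem s_eq_map {n : ℕ} (i : Fin (n + 1)) (e : E _⦋n⦌) :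
    E.s i e = (E.map (SimplexCategory.σ i).op).hom e := rfl

/-- `E_1` is generated by the degenerate image of `E_0` and the `β b`; any operator sends the former
to the image of `E_0` under the iterated degeneracy, so only the `β b` need checking. -/
theorem polyMap_zero_induction {B : Type v} {β : B → E _⦋1⦌}
    (hβ : Function.Surjective (polyMap β 0)) {n : ℕ} {P : Type*} [CommRing P]
    (f : P →+* E _⦋n⦌) (hr : ∀ r : E _⦋0⦌,
      (E.map (SimplexCategory.const ⦋n⦌ ⦋0⦌ 0).op).hom r ∈ f.range)
    (α : ⦋n⦌ ⟶ ⦋1⦌) (hα : ∀ b, (E.map α.op).hom (β b) ∈ f.range) (e : E _⦋1⦌) :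
    (E.map α.op).hom e ∈ f.range := by
  obtain ⟨p, rfl⟩ := hβ e
  induction p using MvPolynomial.induction_on with
  | C r =>
    rw [polyMap_C, s_eq_map, map_map, SimplexCategory.eq_const_to_zero (α ≫ _)]
    exact hr r
  | add p q hp hq => rw [map_add, map_add]; exact add_mem hp hq
  | mul_X p b hp =>
    rw [map_mul, map_mul, polyMap_X, SimplexCategory.lastCut_zero, map_id_apply]
    exact mul_mem hp (hα b)

theorem epiMap_surjective (hE : E.IsSkeletal 1) {B : Type v} {β : B → E _⦋1⦌}
    (hβ : Function.Surjective (polyMap β 0)) (n : ℕ) : Function.Surjective (epiMap β n) := by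
  have hr : ∀ r : E _⦋0⦌,
      (E.map (SimplexCategory.const ⦋n⦌ ⦋0⦌ 0).op).hom r ∈ (epiMap β n).range :=
    fun r => ⟨.C r, epiMap_C _ _ _⟩
  refine surjective_of_operators_mem hE _ (fun c => ?_) fun α e => ?_
  · rw [← AlgHom.commutes (E.map (SimplexCategory.const ⦋n⦌ ⦋0⦌ 0).op).hom]
    exact hr _
  · refine polyMap_zero_induction hβ _ hr α (fun b => ?_) e
    obtain h | ⟨γ, rfl⟩ := SimplexCategory.epi_or_eq_const_comp α
    · exact ⟨.X (⟨α, h⟩, b), epiMap_X _ _ _⟩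
    · rw [← map_map]
      exact hr _

theorem polyMap_surjective (hE : E.IsSkeletal 1) {B : Type v} {β : B → E _⦋1⦌}
    (hβ : Function.Surjective (polyMap β 0)) (n : ℕ) : Function.Surjective (polyMap β n) := by
  have hs : ∀ e : E _⦋n⦌, E.s (Fin.last n) e ∈ (polyMap β n).range :=
    fun e => ⟨.C e, polyMap_C _ _ _⟩
  refine surjective_of_operators_mem hE _ (fun c => ?_) fun α e => ?_
  · rw [← AlgHom.commutes (E.s (Fin.last n))]
    exact hs _
  · obtain rfl | ⟨α, rfl⟩ := SimplexCategory.eq_lastCut_or α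
    · refine polyMap_zero_induction hβ _ (fun r => ?_) _
        (fun b => ⟨.X b, polyMap_X _ _ _⟩) e
      rw [← const_map_const (SimplexCategory.σ (Fin.last n))]
      exact hs _
    · rw [← map_map]
      exact hs _

theorem polyMap_zero_surjective {F : SimpAlg.{u, v} k} {ι : E ⟶ F} (hι : IsSkeleton 1 ι)
    {S : ∀ m : ℕ, Set (F _⦋m + 1⦌)} (hS : Function.Surjective (F.freeMap S 1))
    {β : S 0 → E _⦋1⦌} (hβ : ∀ b, (ι.app (.op ⦋1⦌)).hom (β b) = b.1) :
    Function.Surjective (polyMap β 0) := by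
  intro e
  obtain ⟨p, hp⟩ := hS ((ι.app (.op ⦋1⦌)).hom e)
  suffices ∃ q, (ι.app (.op ⦋1⦌)).hom (polyMap β 0 q) = F.freeMap S 1 p by
    obtain ⟨q, hq⟩ := this
    exact ⟨q, (hι.app_bijective 1 le_rfl).1 (hq.trans hp)⟩
  clear hp
  induction p using MvPolynomial.induction_on with
  | C r =>
    obtain ⟨r, rfl⟩ := (hι.app_bijective 0 zero_le_one).2 r
    refine ⟨.C r, ?_⟩
    rw [polyMap_C, freeMap_C, s_eq_map, app_map,
      SimplexCategory.eq_const_to_zero (SimplexCategory.σ _)]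
  | add p q hp hq =>
    obtain ⟨p', hp⟩ := hp
    obtain ⟨q', hq⟩ := hq
    exact ⟨p' + q', by rw [map_add, map_add, map_add, hp, hq]⟩
  | mul_X p j hp =>
    obtain ⟨p', hp⟩ := hp
    obtain ⟨m, ⟨θ, hθ⟩, b⟩ := j
    -- A surjection from `⦋1⦌` onto `⦋m + 1⦌` forces `m = 0`, and it is then the identity.
    obtain rfl : m = 0 := by
      have := SimplexCategory.le_of_epi θ
      omega
    refine ⟨p' * .X b, ?_⟩
    rw [map_mul, map_mul, map_mul, hp, polyMap_X, freeMap_X, SimplexCategory.lastCut_zero,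
      map_id_apply, hβ]
    obtain rfl := SimplexCategory.eq_id_of_epi θ
    rw [map_id_apply]

/-- Cover the coefficients `E_n` by a polynomial algebra over `E_0` through `epiMap`. The resulting
map from polynomials over `E_0` to `F_{n+1}` sends distinct indeterminates to distinct free
indeterminates of `F`, so it is injective; surjectivity of `epiMap` then transfers injectivity to
`polyMap`. -/
theorem polyMap_injective {F : SimpAlg.{u, v} k} {ι : E ⟶ F} (hι : IsSkeleton 1 ι)
    {S : ∀ m : ℕ, Set (F _⦋m + 1⦌)} (hS : ∀ n, Function.Bijective (F.freeMap S n))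
    {β : S 0 → E _⦋1⦌} (hβ : ∀ b, (ι.app (.op ⦋1⦌)).hom (β b) = b.1) (n : ℕ) :
    Function.Injective (polyMap β n) := by
  -- An indeterminate in dimension `n + 1` is new (indexed by `lastCut n`) or comes from dimension
  -- `n` through the last degeneracy.
  let J : S 0 ⊕ ({θ : ⦋n⦌ ⟶ ⦋1⦌ // Epi θ} × S 0) → F.FreeIndex S (n + 1) :=
    Sum.elim (fun b => ⟨0, ⟨SimplexCategory.lastCut n, inferInstance⟩, b⟩)
      (fun j => ⟨0, ⟨SimplexCategory.σ (Fin.last n) ≫ j.1.1,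
        have := j.1.2; inferInstance⟩, j.2⟩)
  have hJ : Function.Injective J := by
    have h0 : ∀ {x y : {θ : ⦋n + 1⦌ ⟶ ⦋1⦌ // Epi θ} × S 0},
        (⟨0, x⟩ : F.FreeIndex S (n + 1)) = ⟨0, y⟩ → x.1.1 = y.1.1 ∧ x.2 = y.2 := by
      intro x y h
      obtain rfl := eq_of_heq (Sigma.mk.inj h).2
      exact ⟨rfl, rfl⟩
    rintro (b | ⟨⟨θ, hθ⟩, b⟩) (b' | ⟨⟨θ', hθ'⟩, b'⟩) h
    · exact congrArg Sum.inl (h0 h).2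
    · exact absurd (h0 h).1.symm (SimplexCategory.σ_last_comp_ne_lastCut θ')
    · exact absurd (h0 h).1 (SimplexCategory.σ_last_comp_ne_lastCut θ)
    · obtain ⟨h1, rfl⟩ := h0 h
      obtain rfl := (cancel_epi _).1 h1
      rfl
  let ι₀ : E _⦋0⦌ →+* F _⦋0⦌ := (ι.app (.op ⦋0⦌)).hom
  let ι₁ : E _⦋n + 1⦌ →+* F _⦋n + 1⦌ := (ι.app (.op ⦋n + 1⦌)).hom
  let Q := (MvPolynomial.sumAlgEquiv (E _⦋0⦌) (S 0) ({θ : ⦋n⦌ ⟶ ⦋1⦌ // Epi θ} × S 0)).symm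
  have key : (ι₁.comp (polyMap β n)).comp (MvPolynomial.map (epiMap β n)) =
      (((F.freeMap S (n + 1)).comp (MvPolynomial.rename (R := F _⦋0⦌) J).toRingHom).comp
        (MvPolynomial.map ι₀)).comp Q.toRingEquiv.toRingHom := by
    refine MvPolynomial.ringHom_ext (fun r => ?_) (fun b => ?_)
    · induction r using MvPolynomial.induction_on with
      | C r =>
        simp [Q, ι₀, ι₁, s_eq_map, const_map_const]
      | add p q hp hq => rw [map_add, map_add, map_add, hp, hq]
      | mul_X p j hp =>
        rw [map_mul, map_mul, map_mul, hp]
        congr 1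
        simp only [RingHom.comp_apply, MvPolynomial.map_C, polyMap_C, epiMap_X, s_eq_map, map_map]
        simp [Q, ι₁, J, hβ, -op_comp]
    · simp [Q, ι₁, J, hβ]
  have hinj : Function.Injective ((ι₁.comp (polyMap β n)).comp
      (MvPolynomial.map (epiMap β n))) := by
    rw [key]
    exact (((hS (n + 1)).1.comp (MvPolynomial.rename_injective J hJ)).comp
      (MvPolynomial.map_injective ι₀ (hι.app_bijective 0 zero_le_one).1)).comp Q.injective
  refine (injective_iff_map_eq_zero _).2 fun p hp => ?_
  obtain ⟨q, rfl⟩ := MvPolynomial.map_surjective (epiMap β n)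
    (epiMap_surjective hι.skeletal (polyMap_zero_surjective hι (hS 1).2 hβ) n) p
  have : q = 0 := (injective_iff_map_eq_zero _).1 hinj q (by
    rw [RingHom.comp_apply, RingHom.comp_apply, hp, map_zero])
  rw [this, map_zero]

/-- The elements `β b ∈ E_1` with `d_0 (β b) = 0` exhibit `E` as a free simplicial algebra with
all indeterminates in dimension one: every `E_{n+1}` is a polynomial algebra over `E_n`. -/
structure IsOneFree {B : Type v} (β : B → E _⦋1⦌) : Prop where
  d_zero : ∀ b, E.d (0 : Fin 2) (β b) = 0
  bijective : ∀ n, Function.Bijective (polyMap β n)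

theorem IsSkeleton.exists_isOneFree {F : SimpAlg.{u, v} k} (hF : F.IsFree) {ι : E ⟶ F}
    (hι : IsSkeleton 1 ι) : ∃ (B : Type v) (β : B → E _⦋1⦌), IsOneFree β := by
  obtain ⟨S, hd, hS⟩ := hF
  choose β hβ using fun b : S 0 => (hι.app_bijective 1 le_rfl).2 b.1
  refine ⟨S 0, β, fun b => (hι.app_bijective 0 zero_le_one).1 ?_, fun n =>
    ⟨polyMap_injective hι hS hβ n,
      polyMap_surjective hι.skeletal (polyMap_zero_surjective hι (hS 1).2 hβ) n⟩⟩
  rw [map_zero]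
  refine Eq.trans (app_map ι (SimplexCategory.δ (0 : Fin 2)) (β b)) ?_
  rw [hβ]
  exact hd 0 b b.2 0

end SimpAlg
/-! #### Ideals extended along a section -/

/-- The operator `w ↦ w - s (d w)` fixes `Ker d` and sends `J.map s` into the product: it kills the
generators `s a`, and it obeys a Leibniz-type rule for multiples. -/
theorem Ideal.mem_map_mul_ker_of_leftInverse {A B : Type*} [CommRing A] [CommRing B] {s : A →+* B}
    {d : B →+* A} (hds : ∀ a, d (s a) = a) {J : Ideal A} {w : B} (hw : w ∈ J.map s)
    (hd : d w = 0) : w ∈ J.map s * RingHom.ker d := by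
  suffices ∀ w ∈ J.map s, w - s (d w) ∈ J.map s * RingHom.ker d by
    simpa [hd] using this w hw
  intro w hw
  induction hw using Submodule.span_induction with
  | mem x hx =>
    obtain ⟨a, _, rfl⟩ := hx
    simp [hds]
  | zero => simp
  | add x y _ _ hx hy =>
    rw [map_add, map_add, add_sub_add_comm]
    exact add_mem hx hy
  | smul b x hxJ hx =>
    have h : b • x - s (d (b • x)) = x * (b - s (d b)) + s (d b) * (x - s (d x)) := by
      simp only [smul_eq_mul, map_mul]
      ring
    rw [h]
    refine add_mem (Ideal.mul_mem_mul hxJ ?_) (Ideal.mul_mem_left _ _ hx)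
    rw [RingHom.mem_ker, map_sub, hds, sub_self]

section

variable {A B : Type*} [CommRing A] [CommRing B] [Algebra A B]

/-- The projection `b ↦ b - algebraMap A B (d b)` makes the kernel an `A`-linear retract of `B`. -/
theorem Module.Flat.ker_of_leftInverse [Module.Flat A B] {d : B →+* A}
    (hd : ∀ a, d (algebraMap A B a) = a) : Module.Flat A (RingHom.ker d) := by
  refine Module.Flat.of_retract ((RingHom.ker d).subtype.restrictScalars A)
    { toFun := fun b => ⟨b - algebraMap A B (d b), by
        rw [RingHom.mem_ker, map_sub, hd, sub_self]⟩
      map_add' := fun b b' => Subtype.ext (by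
        change (b + b') - algebraMap A B (d (b + b'))
          = (b - algebraMap A B (d b)) + (b' - algebraMap A B (d b'))
        rw [map_add, map_add]; ring)
      map_smul' := fun a b => Subtype.ext (by
        change a • b - algebraMap A B (d (a • b)) = a • (b - algebraMap A B (d b))
        rw [Algebra.smul_def, Algebra.smul_def, map_mul, map_mul, hd]; ring) } ?_
  refine LinearMap.ext fun b => Subtype.ext ?_
  have : d b.1 = 0 := b.2
  simp [this]

/-- If `B` is a flat `A`-algebra with augmentation ideal `K`, then the multiplication
`JB ⊗ K → B` is injective for every ideal `J` of `A`. -/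
theorem Ideal.mulMap_map_ker_injective [Module.Flat A B] {d : B →+* A}
    (hd : ∀ a, d (algebraMap A B a) = a) (J : Ideal A) :
    Function.Injective (Submodule.mulMap (J.map (algebraMap A B)) (RingHom.ker d)) := by
  have := Module.Flat.ker_of_leftInverse hd
  -- The base-change map `J ⊗_A K → JB ⊗_B K` is onto. Its composite with multiplication is `J ⊗_A K
  -- → K`, injective because `K` is flat over `A`; hence multiplication itself is injective.
  let ψ : J ⊗[A] RingHom.ker d →+ J.map (algebraMap A B) ⊗[B] RingHom.ker d :=
    TensorProduct.liftAddHom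
      { toFun := fun j =>
          { toFun := fun t => ⟨algebraMap A B j, Ideal.mem_map_of_mem _ j.2⟩ ⊗ₜ t
            map_zero' := TensorProduct.tmul_zero _ _
            map_add' := fun t t' => TensorProduct.tmul_add _ _ _ }
        map_zero' := by
          ext t
          have h : (⟨algebraMap A B 0, Ideal.mem_map_of_mem _ J.zero_mem⟩ :
              J.map (algebraMap A B)) = 0 := Subtype.ext (map_zero (algebraMap A B))
          exact (congrArg (· ⊗ₜ[B] t) h).trans (TensorProduct.zero_tmul _ t)
        map_add' := fun j j' => by
          ext t
          change _ = _ ⊗ₜ[B] t + _ ⊗ₜ[B] t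
          rw [← TensorProduct.add_tmul]
          change (⟨algebraMap A B (j + j'), _⟩ : J.map (algebraMap A B)) ⊗ₜ[B] t = _
          congr 1
          exact Subtype.ext (map_add _ _ _) }
      (fun a j t => by
        change (⟨algebraMap A B (a • j : J), _⟩ : J.map (algebraMap A B)) ⊗ₜ[B] t = _ ⊗ₜ[B] (a • t)
        rw [← algebraMap_smul B a t, ← TensorProduct.smul_tmul]
        congr 1
        exact Subtype.ext (map_mul _ _ _))
  have hψ : ∀ j t, ψ (j ⊗ₜ t) = ⟨algebraMap A B j, Ideal.mem_map_of_mem _ j.2⟩ ⊗ₜ t :=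
    fun _ _ => rfl
  have hsurj : ∀ c, c ∈ ψ.range := by
    intro c
    induction c using TensorProduct.induction_on with
    | zero => exact zero_mem _
    | add c c' hc hc' => exact add_mem hc hc'
    | tmul x t =>
      obtain ⟨x, hx⟩ := x
      revert t
      induction hx using Submodule.span_induction with
      | mem x hx =>
        obtain ⟨j, hj, rfl⟩ := hx
        exact fun t => ⟨⟨j, hj⟩ ⊗ₜ t, rfl⟩
      | zero =>
        intro t
        convert zero_mem ψ.range
        exact TensorProduct.zero_tmul _ t
      | add x y hx hy ihx ihy =>
        intro t
        convert add_mem (ihx t) (ihy t)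
        exact TensorProduct.add_tmul (⟨x, hx⟩ : J.map (algebraMap A B)) ⟨y, hy⟩ t
      | smul b x hx ih =>
        intro t
        convert ih (b • t) using 1
        exact TensorProduct.smul_tmul b (⟨x, hx⟩ : J.map (algebraMap A B)) t
  let g : J ⊗[A] RingHom.ker d →ₗ[A] RingHom.ker d :=
    (TensorProduct.lid A (RingHom.ker d)).toLinearMap ∘ₗ
      LinearMap.rTensor (RingHom.ker d) J.subtype
  have hg : Function.Injective g :=
    (TensorProduct.lid A (RingHom.ker d)).injective.comp
      (Module.Flat.rTensor_preserves_injective_linearMap _ J.subtype_injective)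
  have hmul : ∀ c, Submodule.mulMap (J.map (algebraMap A B)) (RingHom.ker d) (ψ c) = g c := by
    intro c
    induction c using TensorProduct.induction_on with
    | zero => rw [map_zero, map_zero, g.map_zero, Submodule.coe_zero]
    | add c c' hc hc' => rw [map_add, map_add, hc, hc', g.map_add, Submodule.coe_add]
    | tmul j t =>
      rw [hψ, Submodule.mulMap_tmul]
      exact (Algebra.smul_def (j : A) (t : B)).symm
  refine (injective_iff_map_eq_zero _).2 fun c hc => ?_
  obtain ⟨c, rfl⟩ := hsurj c
  rw [hmul] at hc
  have h0 : c = 0 := hg ((Subtype.ext hc).trans g.map_zero.symm)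
  rw [h0, map_zero]

end
namespace SimpAlg

variable {k : Type u} [CommRing k] {E : SimpAlg.{u, v} k}

/-! ### Simplicial identities on elements. -/

section Identities

variable (E)

theorem d_s_self {n : ℕ} (i : Fin (n + 1)) (e : E _⦋n⦌) : E.d i.castSucc (E.s i e) = e :=
  congrArg (fun f => f.hom e) (E.δ_comp_σ_self (i := i))

theorem d_s_succ {n : ℕ} (i : Fin (n + 1)) (e : E _⦋n⦌) : E.d i.succ (E.s i e) = e :=
  congrArg (fun f => f.hom e) (E.δ_comp_σ_succ (i := i))

theorem d_s_of_le {n : ℕ} {i : Fin (n + 2)} {j : Fin (n + 1)} (h : i ≤ j.castSucc)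
    (e : E _⦋n + 1⦌) : E.d i.castSucc (E.s j.succ e) = E.s j (E.d i e) :=
  congrArg (fun f => f.hom e) (E.δ_comp_σ_of_le h)

theorem d_s_of_gt {n : ℕ} {i : Fin (n + 2)} {j : Fin (n + 1)} (h : j.castSucc < i)
    (e : E _⦋n + 1⦌) : E.d i.succ (E.s j.castSucc e) = E.s j (E.d i e) :=
  congrArg (fun f => f.hom e) (E.δ_comp_σ_of_gt h)

end Identities

/-! #### Ideals in the Moore complex of a free skeleton -/

/-- A face other than the last two commutes with the last degeneracy up to a shift and preserves
`lastCut`, so it fixes the indeterminates and acts on coefficients. -/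
theorem d_polyMap {B : Type v} {β : B → E _⦋1⦌} (n : ℕ) (i : Fin (n + 1))
    (p : MvPolynomial B (E _⦋n + 1⦌)) :
    E.d i.castSucc.castSucc (polyMap β (n + 1) p)
      = polyMap β n (MvPolynomial.map (E.d i.castSucc : E _⦋n + 1⦌ →+* E _⦋n⦌) p) := by
  induction p using MvPolynomial.induction_on with
  | C e =>
    rw [polyMap_C, MvPolynomial.map_C, polyMap_C]
    exact E.d_s_of_le (j := Fin.last n) (Fin.castSucc_le_castSucc_iff.2 (Fin.le_last i)) e
  | add p q hp hq => rw [map_add, map_add, hp, hq, map_add, map_add]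
  | mul_X p b hp =>
    rw [map_mul, map_mul, hp, map_mul, map_mul, MvPolynomial.map_X, polyMap_X, polyMap_X]
    congr 1
    rw [← SimplexCategory.δ_comp_lastCut n i.castSucc]
    exact E.map_map _ _ _

theorem mem_moore_succ {n : ℕ} {w : E _⦋n + 1⦌} :
    w ∈ E.moore (n + 1) ↔ ∀ i : Fin (n + 1), E.d i.castSucc w = 0 := by
  change w ∈ (⨅ i : Fin (n + 1), RingHom.ker (E.d i.castSucc) : Ideal (E _⦋n + 1⦌)) ↔ _
  simp only [Ideal.mem_iInf, RingHom.mem_ker]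

theorem moore_one : E.moore 1 = E.kerD 0 := by
  ext w
  rw [mem_moore_succ, RingHom.mem_ker, Fin.forall_fin_one]
  rfl

namespace IsOneFree

variable {B : Type v} {β : B → E _⦋1⦌} (h : IsOneFree β)
include h

theorem flat : letI := (E.s (1 : Fin 2) : E _⦋1⦌ →+* E _⦋2⦌).toAlgebra
    Module.Flat (E _⦋1⦌) (E _⦋2⦌) := by
  let := (E.s (1 : Fin 2) : E _⦋1⦌ →+* E _⦋2⦌).toAlgebra
  let e : MvPolynomial B (E _⦋1⦌) ≃ₐ[E _⦋1⦌] E _⦋2⦌ :=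
    AlgEquiv.ofBijective { polyMap β 1 with commutes' := fun r => polyMap_C β 1 r } (h.bijective 1)
  exact Module.Flat.of_linearEquiv e.symm.toLinearEquiv

theorem mem_map_moore {n : ℕ} {w : E _⦋n + 2⦌}
    (hw : ∀ i : Fin (n + 1), E.d i.castSucc.castSucc w = 0) :
    w ∈ (E.moore (n + 1)).map (E.s (Fin.last (n + 1)) : E _⦋n + 1⦌ →+* E _⦋n + 2⦌) := by
  obtain ⟨p, rfl⟩ := (h.bijective (n + 1)).2 w
  have hp : p ∈ (E.moore (n + 1)).map (MvPolynomial.C (σ := B)) := by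
    refine MvPolynomial.mem_map_C_iff.2 fun m => mem_moore_succ.2 fun i => ?_
    have hi := hw i
    rw [d_polyMap] at hi
    have h0 := (injective_iff_map_eq_zero _).1 (h.bijective n).1 _ hi
    -- Injectivity of `polyMap β n` turns the vanishing of a face into the vanishing of that face on
    -- each coefficient.
    have hm := congrArg (MvPolynomial.coeff m) h0
    rwa [MvPolynomial.coeff_map, MvPolynomial.coeff_zero] at hm
  have := Ideal.mem_map_of_mem (polyMap β (n + 1)) hp
  rw [Ideal.map_map] at this
  convert this
  ext r
  exact (polyMap_C β (n + 1) r).symm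

theorem moore_le (n : ℕ) : E.moore (n + 2) ≤
    (E.moore (n + 1)).map (E.s (Fin.last (n + 1)) : E _⦋n + 1⦌ →+* E _⦋n + 2⦌)
      * RingHom.ker (E.d (Fin.last (n + 1)).castSucc : E _⦋n + 2⦌ →+* E _⦋n + 1⦌) := by
  intro w hw
  rw [mem_moore_succ] at hw
  exact Ideal.mem_map_mul_ker_of_leftInverse (E.d_s_self _)
    (h.mem_map_moore fun i => hw i.castSucc) (hw _)

/-- Apply the last face to `moore_le`: it retracts the last degeneracy, so it returns the extended
ideal to `NE_{n+1}`, and `d_{n+1} d_{n+2} = d_{n+1} d_{n+1}` carries the kernel factor into `Ker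
d_{n+1}`. -/
theorem boundary_mem {n : ℕ} {w : E _⦋n + 2⦌} (hw : w ∈ E.moore (n + 2)) :
    E.d (Fin.last (n + 2)) w ∈
      E.moore (n + 1) * RingHom.ker (E.d (Fin.last (n + 1)) : E _⦋n + 1⦌ →+* E _⦋n⦌) := by
  have := Ideal.mem_map_of_mem (E.d (Fin.last (n + 2)) : E _⦋n + 2⦌ →+* E _⦋n + 1⦌)
    (h.moore_le n hw)
  rw [Ideal.map_mul, Ideal.map_map] at this
  refine Ideal.mul_mono ?_ ?_ this
  · refine Ideal.map_le_iff_le_comap.2 fun x hx => ?_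
    change E.d (Fin.last (n + 1)).succ (E.s (Fin.last (n + 1)) x) ∈ E.moore (n + 1)
    rwa [d_s_succ]
  · refine Ideal.map_le_iff_le_comap.2 fun x hx => ?_
    rw [Ideal.mem_comap, RingHom.mem_ker]
    have hx' : E.d (Fin.last (n + 1)).castSucc x = 0 := hx
    change E.d (Fin.last (n + 1)) (E.d (Fin.last (n + 1)).succ x) = 0
    rw [d_d le_rfl, hx', map_zero]

end IsOneFree

/-! #### Products of kernels that are boundaries -/

theorem mul_mem_boundaries_of_moore_three {z : E.moore 2} (X Y : E _⦋3⦌)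
    (h : ∀ i : Fin 3, E.d i.castSucc X = 0 ∨ E.d i.castSucc Y = 0)
    (hz : E.d (3 : Fin 4) X * E.d (3 : Fin 4) Y = z) : z ∈ E.boundaries 2 := by
  refine ⟨X * Y, mem_moore_succ.2 fun i => ?_, (map_mul _ _ _).trans hz⟩
  rw [map_mul]
  obtain h | h := h i <;> simp [h]

theorem mem_boundaries_of_left {z : E.moore 2} {x y : E _⦋2⦌} (hz : (z : E _⦋2⦌) = x * y)
    (hx0 : E.d (0 : Fin 3) x = 0) (hx2 : E.d (2 : Fin 3) x = 0) (hy1 : E.d (1 : Fin 3) y = 0) :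
    z ∈ E.boundaries 2 := by
  have a1 := E.d_s_of_le (i := 0) (j := 0) (by simp) x
  have a2 := E.d_s_of_le (i := 0) (j := 1) (by simp) x
  have b1 := E.d_s_self 2 x
  have b2 := E.d_s_succ 1 x
  have c1 := E.d_s_succ 2 x
  have c2 := E.d_s_of_gt (i := 2) (j := 1) (by decide) x
  have e1 := E.d_s_of_le (i := 1) (j := 1) (by decide) y
  have e2 := E.d_s_succ 2 y
  -- The first factor is killed by `d_0` and `d_2`, the second by `d_1`; `d_3` sends them to `x` and
  -- `y` because `d_3 s_1 x = s_1 d_2 x = 0`.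
  refine mul_mem_boundaries_of_moore_three (E.s (2 : Fin 3) x - E.s (1 : Fin 3) x)
    (E.s (2 : Fin 3) y) ?_ ?_
  · intro i
    fin_cases i
    · left
      refine (map_sub _ _ _).trans ?_
      refine (congrArg₂ _ a2 a1).trans ?_
      rw [hx0]; simp
    · right
      refine e1.trans ?_
      rw [hy1]; simp
    · left
      refine (map_sub _ _ _).trans ?_
      exact (congrArg₂ _ b1 b2).trans (sub_self _)
  · rw [map_sub]
    refine (congrArg₂ _ (congrArg₂ _ c1 c2) e2).trans ?_
    rw [hx2, map_zero, sub_zero, hz]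

theorem mem_boundaries_of_right {z : E.moore 2} {x y : E _⦋2⦌} (hz : (z : E _⦋2⦌) = y * x)
    (hx1 : E.d (1 : Fin 3) x = 0) (hx2 : E.d (2 : Fin 3) x = 0) (hy0 : E.d (0 : Fin 3) y = 0) :
    z ∈ E.boundaries 2 := by
  have a0 := E.d_s_succ 0 x
  have a1 := E.d_s_self 1 x
  have a2 := E.d_s_of_le (i := 1) (j := 1) (by decide) x
  have b0 := E.d_s_of_gt (i := 1) (j := 0) (by decide) x
  have b1 := E.d_s_succ 1 x
  have b2 := E.d_s_self 2 x
  have c0 := E.d_s_of_gt (i := 2) (j := 0) (by decide) x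
  have c1 := E.d_s_of_gt (i := 2) (j := 1) (by decide) x
  have c2 := E.d_s_succ 2 x
  have e1 := E.d_s_of_le (i := 0) (j := 1) (by decide) y
  have e2 := E.d_s_succ 2 y
  -- The term `s_2 x - s_1 x` is killed by `d_2` but has `d_1` equal to `-x`. Adding `s_0 x` cancels
  -- this, and `d_2 s_0 x = s_0 d_1 x = 0` does no harm.
  refine mul_mem_boundaries_of_moore_three
    (E.s (2 : Fin 3) x - E.s (1 : Fin 3) x + E.s (0 : Fin 3) x) (E.s (2 : Fin 3) y) ?_ ?_
  · intro i
    fin_cases i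
    · right
      refine e1.trans ?_
      rw [hy0]; simp
    · left
      refine (map_add _ _ _).trans (congrArg₂ _ (map_sub _ _ _) rfl) |>.trans ?_
      refine (congrArg₂ _ (congrArg₂ _ a2 a1) a0).trans ?_
      rw [hx1]; simp
    · left
      refine (map_add _ _ _).trans (congrArg₂ _ (map_sub _ _ _) rfl) |>.trans ?_
      refine (congrArg₂ _ (congrArg₂ _ b2 b1) b0).trans ?_
      rw [hx1]; simp
  · rw [map_add, map_sub]
    refine (congrArg₂ _ (congrArg₂ _ (congrArg₂ _ c2 c1) c0) e2).trans ?_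
    rw [hx2, map_zero, map_zero, sub_zero, add_zero, hz, mul_comm]

end SimpAlg
namespace SimpAlg

variable {k : Type u} [CommRing k] {E : SimpAlg.{u, v} k}

/-! #### The comparison map -/

theorem mem_moore_two_of_mul {X T : E _⦋2⦌} (hX : E.d (0 : Fin 3) X = 0)
    (hT : E.d (1 : Fin 3) T = 0) : X * T ∈ E.moore 2 := by
  rw [mem_moore_two, map_mul, map_mul, hX, hT]
  simp

variable (E) in
/-- The difference `s_1 - s_0 : E_1 → E_2` of the degeneracies. -/
def sDiff : E _⦋1⦌ →+ E _⦋2⦌ :=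
  (E.s (1 : Fin 2)).toRingHom.toAddMonoidHom - (E.s (0 : Fin 2)).toRingHom.toAddMonoidHom

theorem sDiff_apply (z : E _⦋1⦌) : E.sDiff z = E.s (1 : Fin 2) z - E.s (0 : Fin 2) z := rfl

theorem d_one_sDiff (z : E _⦋1⦌) : E.d (1 : Fin 3) (E.sDiff z) = 0 := by
  rw [sDiff_apply, map_sub]
  exact sub_eq_zero.2 ((E.d_s_self 1 z).trans (E.d_s_succ 0 z).symm)

theorem d_two_s_one (z : E _⦋1⦌) : E.d (2 : Fin 3) (E.s (1 : Fin 2) z) = z := E.d_s_succ 1 z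

theorem d_two_s_zero (z : E.kerD 1) : E.d (2 : Fin 3) (E.s (0 : Fin 2) z) = 0 := by
  have hz : E.d (1 : Fin 2) (z : E _⦋1⦌) = 0 := z.2
  refine (E.d_s_of_gt (i := 1) (j := 0) (by decide) (z : E _⦋1⦌)).trans ?_
  rw [hz, map_zero]

theorem d_two_sDiff (z : E.kerD 1) : E.d (2 : Fin 3) (E.sDiff z) = z := by
  rw [sDiff_apply, map_sub, d_two_s_one, d_two_s_zero, sub_zero]

theorem d_zero_s_one (x : E.kerD 0) : E.d (0 : Fin 3) (E.s (1 : Fin 2) x) = 0 := by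
  have hx : E.d (0 : Fin 2) (x : E _⦋1⦌) = 0 := x.2
  refine (E.d_s_of_le (i := 0) (j := 0) (by simp) (x : E _⦋1⦌)).trans ?_
  rw [hx, map_zero]

theorem sDiff_bar (y : E.kerD 0) : E.sDiff (E.bar y) = E.sDiff y := by
  have h : ∀ r : E _⦋0⦌, E.sDiff (E.s (0 : Fin 1) r) = 0 := fun r => by
    rw [sDiff_apply, sub_eq_zero]
    exact congrArg (fun f => f.hom r) (E.σ_comp_σ (i := 0) (j := 0) le_rfl).symm
  change E.sDiff (y - E.s (0 : Fin 1) (E.d (1 : Fin 2) y)) = _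
  rw [map_sub, h, sub_zero]

/-- The class in `NE_2 / ∂_3 (NE_3)` of `X T`, where `d_0 X = 0` and `d_1 T = 0`. -/
def mkMul (X T : E _⦋2⦌) (hX : E.d (0 : Fin 3) X = 0) (hT : E.d (1 : Fin 3) T = 0) :
    E.TopCorner :=
  TopCorner.mk E ⟨X * T, mem_moore_two_of_mul hX hT⟩

/-- Replacing one factor at a time changes the product by an element of `(Ker d_0 ∩ Ker d_2) Ker
d_1` or of `Ker d_0 (Ker d_1 ∩ Ker d_2)`, both made of boundaries. Relations in the quotient can
thus be checked after `d_2`. -/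
theorem mkMul_congr {X X' T T' : E _⦋2⦌} (hX : E.d (0 : Fin 3) X = 0)
    (hX' : E.d (0 : Fin 3) X' = 0) (hT : E.d (1 : Fin 3) T = 0) (hT' : E.d (1 : Fin 3) T' = 0)
    (h : E.d (2 : Fin 3) X = E.d (2 : Fin 3) X') (h' : E.d (2 : Fin 3) T = E.d (2 : Fin 3) T') :
    mkMul X T hX hT = mkMul X' T' hX' hT' := by
  have h1 : mkMul X T hX hT = mkMul X' T hX' hT := by
    refine TopCorner.mk_eq.2 (mem_boundaries_of_left (x := X - X') (y := T) ?_ ?_ ?_ hT)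
    · exact (sub_mul _ _ _).symm
    · rw [map_sub, hX, hX', sub_zero]
    · rw [map_sub, h, sub_self]
  rw [h1]
  refine TopCorner.mk_eq.2 (mem_boundaries_of_right (x := T - T') (y := X') ?_ ?_ ?_ hX')
  · exact (mul_sub _ _ _).symm
  · rw [map_sub, hT, hT', sub_zero]
  · rw [map_sub, h', sub_self]

theorem mkMul_add_left {X X' T : E _⦋2⦌} (hX : E.d (0 : Fin 3) X = 0)
    (hX' : E.d (0 : Fin 3) X' = 0) (hT : E.d (1 : Fin 3) T = 0)
    (h : E.d (0 : Fin 3) (X + X') = 0) :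
    mkMul (X + X') T h hT = mkMul X T hX hT + mkMul X' T hX' hT := by
  rw [mkMul, mkMul, mkMul, ← map_add]
  exact congrArg _ (Subtype.ext (add_mul _ _ _))

theorem mkMul_add_right {X T T' : E _⦋2⦌} (hX : E.d (0 : Fin 3) X = 0)
    (hT : E.d (1 : Fin 3) T = 0) (hT' : E.d (1 : Fin 3) T' = 0)
    (h : E.d (1 : Fin 3) (T + T') = 0) :
    mkMul X (T + T') hX h = mkMul X T hX hT + mkMul X T' hX hT' := by
  rw [mkMul, mkMul, mkMul, ← map_add]
  exact congrArg _ (Subtype.ext (mul_add _ _ _))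

theorem smul_mkMul (e : E _⦋1⦌) {X T : E _⦋2⦌} (hX : E.d (0 : Fin 3) X = 0)
    (hT : E.d (1 : Fin 3) T = 0) (h : E.d (0 : Fin 3) (E.s (1 : Fin 2) e * X) = 0) :
    e • mkMul X T hX hT = mkMul (E.s (1 : Fin 2) e * X) T h hT := by
  rw [mkMul, mkMul, TopCorner.smul_mk]
  exact congrArg _ (Subtype.ext (mul_assoc _ _ _).symm)

theorem mkMul_mul_mkMul {X X' T T' : E _⦋2⦌} (hX : E.d (0 : Fin 3) X = 0)
    (hX' : E.d (0 : Fin 3) X' = 0) (hT : E.d (1 : Fin 3) T = 0) (hT' : E.d (1 : Fin 3) T' = 0)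
    (h : E.d (0 : Fin 3) (X * X') = 0) (h' : E.d (1 : Fin 3) (T * T') = 0) :
    mkMul X T hX hT * mkMul X' T' hX' hT' = mkMul (X * X') (T * T') h h' := by
  rw [mkMul, mkMul, mkMul, ← TopCorner.mk_mul]
  exact congrArg _ (Subtype.ext (mul_mul_mul_comm _ _ _ _))

variable (E)

/-- The bilinear map `(z, x) ↦ s_1 x (s_1 z - s_0 z) + ∂_3 (NE_3)` on `Ker d_1 × Ker d_0`. -/
def topPairing (z : E.kerD 1) (x : E.kerD 0) : E.TopCorner :=
  mkMul (E.s (1 : Fin 2) x) (E.sDiff z) (d_zero_s_one x) (d_one_sDiff _)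

theorem topPairing_bar (x y : E.kerD 0) :
    E.topPairing (E.bar y) x = TopCorner.mk E (E.hElt x y) :=
  congrArg (TopCorner.mk E) (Subtype.ext (by
    change E.s (1 : Fin 2) (x : E _⦋1⦌) * E.sDiff (E.bar y) = _
    rw [sDiff_bar]
    rfl))

theorem mkMul_eq_topPairing {X T : E _⦋2⦌} (hX : E.d (0 : Fin 3) X = 0)
    (hT : E.d (1 : Fin 3) T = 0) (z : E.kerD 1) (x : E.kerD 0)
    (hx : E.d (2 : Fin 3) X = x) (hz : E.d (2 : Fin 3) T = z) :
    mkMul X T hX hT = E.topPairing z x :=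
  mkMul_congr _ _ _ _ (hx.trans (d_two_s_one _).symm) (hz.trans (d_two_sDiff z).symm)

theorem topPairing_mul (z z' : E.kerD 1) (x x' : E.kerD 0) :
    E.topPairing z x * E.topPairing z' x' = E.topPairing (z * z') (x * x') := by
  refine (mkMul_mul_mkMul _ _ _ _ (by rw [map_mul, d_zero_s_one, zero_mul])
    (by rw [map_mul, d_one_sDiff, zero_mul])).trans (E.mkMul_eq_topPairing _ _ _ _ ?_ ?_)
  · rw [map_mul, d_two_s_one, d_two_s_one]; rfl
  · rw [map_mul, d_two_sDiff, d_two_sDiff]; rfl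

/-- The comparison map `Ker d_1 ⊗ Ker d_0 → NE_2 / ∂_3 (NE_3)`. -/
def tensorToTop : (E.kerCM 1).Tensor (E.kerCM 0) →ₗ[E _⦋1⦌] E.TopCorner :=
  TensorProduct.lift (LinearMap.mk₂ (E _⦋1⦌) E.topPairing
    (fun z z' x => by
      refine Eq.trans ?_ (mkMul_add_right _ _ _ (by rw [← map_add, d_one_sDiff]))
      refine (E.mkMul_eq_topPairing _ _ _ _ (d_two_s_one _) ?_).symm
      rw [map_add, d_two_sDiff, d_two_sDiff]; rfl)
    (fun e z x => by
      refine Eq.trans ?_ (smul_mkMul e _ _ (by rw [map_mul, d_zero_s_one, mul_zero])).symm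
      -- In `E_2` itself `s_1 - s_0` is not `E_1`-linear for the action through `s_1`; `s_1 e (s_1 z
      -- - s_0 z)` only has the same `d_2` as the difference formed from `e z`, which suffices
      -- modulo boundaries.
      refine Eq.trans (E.mkMul_eq_topPairing (X := E.s (1 : Fin 2) x)
        (T := E.s (1 : Fin 2) e * E.sDiff z) (d_zero_s_one x)
        (by rw [map_mul, d_one_sDiff, mul_zero]) _ _ (d_two_s_one _)
        (by rw [map_mul, d_two_s_one, d_two_sDiff]; rfl)).symm
        (congrArg _ (Subtype.ext ?_))
      change _ * (_ * _) = _ * _ * _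
      ring)
    (fun z x x' => by
      refine Eq.trans ?_ (mkMul_add_left _ _ _ (by
        rw [map_add, d_zero_s_one, d_zero_s_one, add_zero]))
      refine (E.mkMul_eq_topPairing _ _ _ _ ?_ (d_two_sDiff _)).symm
      rw [map_add, d_two_s_one, d_two_s_one]; rfl)
    (fun e z x => by
      refine Eq.trans ?_ (smul_mkMul e _ _ (by rw [map_mul, d_zero_s_one, mul_zero])).symm
      refine (E.mkMul_eq_topPairing _ _ _ _ ?_ (d_two_sDiff _)).symm
      rw [map_mul, d_two_s_one, d_two_s_one]; rfl))

theorem tensorToTop_tmul (z : E.kerD 1) (x : E.kerD 0) :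
    E.tensorToTop (z ⊗ₜ x) = E.topPairing z x := rfl

theorem tensorToTop_mul (a b : (E.kerCM 1).Tensor (E.kerCM 0)) :
    E.tensorToTop (a * b) = E.tensorToTop a * E.tensorToTop b := by
  induction a using TensorProduct.induction_on with
  | zero => rw [zero_mul, map_zero, zero_mul]
  | add a a' ha ha' => rw [add_mul, map_add, ha, ha', map_add, add_mul]
  | tmul z x =>
    induction b using TensorProduct.induction_on with
    | zero => rw [mul_zero, map_zero, mul_zero]
    | add b b' hb hb' => rw [mul_add, map_add, hb, hb', map_add, mul_add]
    | tmul z' x' =>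
      rw [Algebra.TensorProduct.tmul_mul_tmul, tensorToTop_tmul, tensorToTop_tmul,
        tensorToTop_tmul, topPairing_mul]

theorem topBd_topPairing (i : Fin 2) (z : E.kerD 1) (x : E.kerD 0) :
    (E.topBd i (E.topPairing z x) : E _⦋1⦌) = x * z := by
  rw [topPairing, mkMul, topBd_mk]
  change E.d (2 : Fin 3) (_ * _) = _
  rw [map_mul, d_two_s_one, d_two_sDiff]

theorem topBd_one_tensorToTop (a : (E.kerCM 1).Tensor (E.kerCM 0)) :
    E.topBd 1 (E.tensorToTop a) = (E.kerCM 1).tensorFst (E.kerCM 0) a := by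
  induction a using TensorProduct.induction_on with
  | zero => simp only [map_zero]
  | add a a' ha ha' => rw [map_add, map_add, ha, ha', map_add]
  | tmul z x => exact Subtype.ext (E.topBd_topPairing 1 z x)

theorem topBd_zero_tensorToTop (a : (E.kerCM 1).Tensor (E.kerCM 0)) :
    E.topBd 0 (E.tensorToTop a) = (E.kerCM 1).tensorSnd (E.kerCM 0) a := by
  induction a using TensorProduct.induction_on with
  | zero => simp only [map_zero]
  | add a a' ha ha' => rw [map_add, map_add, ha, ha', map_add]
  | tmul z x => exact Subtype.ext ((E.topBd_topPairing 0 z x).trans (mul_comm _ _))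

/-! #### Bijectivity of the comparison map -/

/-- The extension along `s_1` of the ideal `Ker d_0` of `E_1`. -/
abbrev extKer : Ideal (E _⦋2⦌) := (E.kerD 0).map (E.s (1 : Fin 2) : E _⦋1⦌ →+* E _⦋2⦌)

theorem d_zero_of_mem_extKer {X : E _⦋2⦌} (hX : X ∈ E.extKer) : E.d (0 : Fin 3) X = 0 := by
  have : E.extKer ≤ RingHom.ker (E.d (0 : Fin 3)) :=
    Ideal.map_le_iff_le_comap.2 fun x hx => d_zero_s_one ⟨x, hx⟩
  exact this hX

/-- The kernel of `d_1 : E_2 → E_1`. -/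
abbrev kerDOne : Ideal (E _⦋2⦌) := RingHom.ker (E.d (1 : Fin 3) : E _⦋2⦌ →+* E _⦋1⦌)

theorem d_two_mem_kerD_zero {X : E _⦋2⦌} (hX : X ∈ E.extKer) : E.d (2 : Fin 3) X ∈ E.kerD 0 := by
  rw [RingHom.mem_ker]
  refine (d_d (E := E) (i := 0) (j := 1) (by simp) X).trans ?_
  exact (congrArg _ (E.d_zero_of_mem_extKer hX)).trans (map_zero _)

theorem d_two_mem_kerD_one {T : E _⦋2⦌} (hT : T ∈ E.kerDOne) : E.d (2 : Fin 3) T ∈ E.kerD 1 := by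
  rw [RingHom.mem_ker]
  refine (d_d (E := E) (i := 1) (j := 1) (by simp) T).trans ?_
  exact (congrArg _ (show E.d (1 : Fin 3) T = 0 from hT)).trans (map_zero _)

/-- The map `X ⊗ T ↦ d_2 T ⊗ d_2 X`. -/
def dTwoTensor : E.extKer ⊗[E _⦋2⦌] E.kerDOne →+ (E.kerCM 1).Tensor (E.kerCM 0) :=
  TensorProduct.liftAddHom
    (AddMonoidHom.mk' (fun X =>
      AddMonoidHom.mk' (fun T =>
        ((⟨_, E.d_two_mem_kerD_one T.2⟩ : E.kerD 1) ⊗ₜ[E _⦋1⦌]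
          (⟨_, E.d_two_mem_kerD_zero X.2⟩ : E.kerD 0) : (E.kerCM 1).Tensor (E.kerCM 0)))
        fun T T' => by
          rw [← TensorProduct.add_tmul]
          congr 1
          exact Subtype.ext (map_add _ _ _))
      fun X X' => by
        ext T
        change _ = _ ⊗ₜ[E _⦋1⦌] _ + _ ⊗ₜ[E _⦋1⦌] _
        rw [← TensorProduct.tmul_add]
        refine congrArg (fun x : E.kerD 0 =>
          (⟨_, E.d_two_mem_kerD_one T.2⟩ : E.kerD 1) ⊗ₜ[E _⦋1⦌] x) ?_
        exact Subtype.ext (map_add _ _ _))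
    fun r X T => by
      change (⟨_, E.d_two_mem_kerD_one T.2⟩ : E.kerD 1) ⊗ₜ[E _⦋1⦌]
          (⟨_, E.d_two_mem_kerD_zero (r • X).2⟩ : E.kerD 0)
        = (⟨_, E.d_two_mem_kerD_one (r • T).2⟩ : E.kerD 1) ⊗ₜ[E _⦋1⦌]
          (⟨_, E.d_two_mem_kerD_zero X.2⟩ : E.kerD 0)
      have h1 : (⟨_, E.d_two_mem_kerD_zero (r • X).2⟩ : E.kerD 0)
          = E.d (2 : Fin 3) r • ⟨_, E.d_two_mem_kerD_zero X.2⟩ := Subtype.ext (map_mul _ _ _)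
      have h2 : (⟨_, E.d_two_mem_kerD_one (r • T).2⟩ : E.kerD 1)
          = E.d (2 : Fin 3) r • ⟨_, E.d_two_mem_kerD_one T.2⟩ := Subtype.ext (map_mul _ _ _)
      -- A scalar `r` of `E_2` acts on both factors through `d_2 r`, so the map is balanced.
      rw [h1, h2, TensorProduct.smul_tmul]

theorem dTwoTensor_tmul (X : E.extKer) (T : E.kerDOne) :
    E.dTwoTensor (X ⊗ₜ T) = (⟨_, E.d_two_mem_kerD_one T.2⟩ : E.kerD 1) ⊗ₜ[E _⦋1⦌]
      (⟨_, E.d_two_mem_kerD_zero X.2⟩ : E.kerD 0) := rfl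

/-- Lift `z ⊗ x` to `s_1 x ⊗ (s_1 z - s_0 z)`. This puts an element of the tensor product and a
representative of its image under one element of `extKer ⊗ kerDOne`, without any freeness. -/
theorem exists_lift_tensor (a : (E.kerCM 1).Tensor (E.kerCM 0)) :
    ∃ c, E.dTwoTensor c = a ∧ ∃ h : Submodule.mulMap E.extKer E.kerDOne c ∈ E.moore 2,
      E.tensorToTop a = TopCorner.mk E ⟨_, h⟩ := by
  induction a using TensorProduct.induction_on with
  | zero =>
    refine ⟨0, map_zero _, by rw [map_zero]; exact zero_mem _, ?_⟩
    rw [map_zero, ← map_zero (TopCorner.mk E)]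
    exact congrArg _ (Subtype.ext (map_zero _).symm)
  | add a a' ha ha' =>
    obtain ⟨c, rfl, h, hc⟩ := ha
    obtain ⟨c', rfl, h', hc'⟩ := ha'
    refine ⟨c + c', map_add _ _ _, by rw [map_add]; exact add_mem h h', ?_⟩
    rw [map_add, hc, hc', ← map_add (TopCorner.mk E)]
    exact congrArg _ (Subtype.ext (map_add _ _ _).symm)
  | tmul z x =>
    refine ⟨⟨E.s (1 : Fin 2) x, Ideal.mem_map_of_mem _ x.2⟩ ⊗ₜ ⟨E.sDiff z, d_one_sDiff _⟩, ?_,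
      mem_moore_two_of_mul (d_zero_s_one x) (d_one_sDiff _), rfl⟩
    rw [dTwoTensor_tmul]
    congr 1
    · exact Subtype.ext (d_two_sDiff z)
    · exact Subtype.ext (d_two_s_one _)

variable {E}

namespace IsOneFree

variable {B : Type v} {β : B → E _⦋1⦌} (h : IsOneFree β)
include h

theorem moore_two_le : E.moore 2 ≤ E.extKer * E.kerDOne := by
  have := h.moore_le 0
  rw [moore_one] at this
  exact this

theorem mulMap_injective : Function.Injective (Submodule.mulMap E.extKer E.kerDOne) := by
  let := (E.s (1 : Fin 2) : E _⦋1⦌ →+* E _⦋2⦌).toAlgebra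
  have := h.flat
  exact Ideal.mulMap_map_ker_injective (d := (E.d (1 : Fin 3) : E _⦋2⦌ →+* E _⦋1⦌))
    (E.d_s_self 1) (E.kerD 0)

/-- A boundary is a sum of products `X T t` with `d_2 t = 0`. Grouping `t` with `T` gives the lift
`X ⊗ T t`, which `dTwoTensor` kills. -/
theorem exists_of_mem_boundaries {z : E.moore 2} (hz : z ∈ E.boundaries 2) :
    ∃ c, Submodule.mulMap E.extKer E.kerDOne c = z ∧ E.dTwoTensor c = 0 := by
  obtain ⟨w, hw, hwz⟩ := hz
  have hz : (z : E _⦋2⦌) ∈ (E.extKer * E.kerDOne) * RingHom.ker (E.d (2 : Fin 3)) := by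
    rw [← hwz]
    exact Ideal.mul_mono_left h.moore_two_le (h.boundary_mem hw)
  clear hwz
  generalize (z : E _⦋2⦌) = y at hz
  induction hz using Submodule.mul_induction_on' with
  | mem_mul_mem u hu t ht =>
    induction hu using Submodule.mul_induction_on' with
    | mem_mul_mem X hX T hT =>
      refine ⟨⟨X, hX⟩ ⊗ₜ ⟨T * t, Ideal.mul_mem_right _ _ hT⟩, (mul_assoc _ _ _).symm, ?_⟩
      rw [dTwoTensor_tmul]
      have h0 : (⟨_, E.d_two_mem_kerD_one (Ideal.mul_mem_right t E.kerDOne hT)⟩ : E.kerD 1) = 0 :=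
        Subtype.ext (by
          change E.d (2 : Fin 3) (T * t) = 0
          rw [map_mul, show E.d (2 : Fin 3) t = 0 from ht, mul_zero])
      rw [h0, TensorProduct.zero_tmul]
    | add x _ y _ hx hy =>
      obtain ⟨c, hc, hc0⟩ := hx
      obtain ⟨c', hc', hc0'⟩ := hy
      exact ⟨c + c', by rw [map_add, hc, hc', add_mul], by rw [map_add, hc0, hc0', add_zero]⟩
  | add x _ y _ hx hy =>
    obtain ⟨c, hc, hc0⟩ := hx
    obtain ⟨c', hc', hc0'⟩ := hy
    exact ⟨c + c', by rw [map_add, hc, hc'], by rw [map_add, hc0, hc0', add_zero]⟩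

theorem tensorToTop_injective : Function.Injective E.tensorToTop := by
  refine (injective_iff_map_eq_zero _).2 fun a ha => ?_
  obtain ⟨c, rfl, hc, hca⟩ := E.exists_lift_tensor a
  rw [hca, TopCorner.mk_eq_zero] at ha
  obtain ⟨c', hc', h0⟩ := h.exists_of_mem_boundaries ha
  -- Both lifts have the same product, so they coincide, and `dTwoTensor` vanishes on one of them.
  rw [← h.mulMap_injective hc', h0]

theorem tensorToTop_surjective : Function.Surjective E.tensorToTop := by
  intro q
  obtain ⟨⟨z, hz⟩, rfl⟩ := TopCorner.mk_surjective q
  suffices ∀ z ∈ E.extKer * E.kerDOne, ∃ (a : _) (hz : z ∈ E.moore 2),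
      E.tensorToTop a = TopCorner.mk E ⟨z, hz⟩ by
    obtain ⟨a, _, ha⟩ := this z (h.moore_two_le hz)
    exact ⟨a, ha⟩
  intro z hz
  induction hz using Submodule.mul_induction_on' with
  | mem_mul_mem X hX T hT =>
    exact ⟨(⟨_, E.d_two_mem_kerD_one hT⟩ : E.kerD 1) ⊗ₜ (⟨_, E.d_two_mem_kerD_zero hX⟩ : E.kerD 0),
      mem_moore_two_of_mul (E.d_zero_of_mem_extKer hX) hT,
      (E.mkMul_eq_topPairing (E.d_zero_of_mem_extKer hX) hT _ _ rfl rfl).symm⟩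
  | add x _ y _ hx hy =>
    obtain ⟨a, hx, ha⟩ := hx
    obtain ⟨b, hy, hb⟩ := hy
    exact ⟨a + b, add_mem hx hy, by rw [map_add, ha, hb, ← map_add]; rfl⟩

end IsOneFree

/-! ### Exchange of the tensor factors and the main theorem. -/

theorem kerCM_comm_mul (a b : (E.kerCM 0).Tensor (E.kerCM 1)) :
    TensorProduct.comm (E _⦋1⦌) (E.kerD 0) (E.kerD 1) (a * b)
      = TensorProduct.comm (E _⦋1⦌) (E.kerD 0) (E.kerD 1) a
        * TensorProduct.comm (E _⦋1⦌) (E.kerD 0) (E.kerD 1) b := by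
  induction a using TensorProduct.induction_on with
  | zero => rw [zero_mul, map_zero, zero_mul]
  | add a a' ha ha' => rw [add_mul, map_add, ha, ha', map_add, add_mul]
  | tmul z x =>
    induction b using TensorProduct.induction_on with
    | zero => rw [mul_zero, map_zero, mul_zero]
    | add b b' hb hb' => rw [mul_add, map_add, hb, hb', map_add, mul_add]
    | tmul z' x' =>
      rw [Algebra.TensorProduct.tmul_mul_tmul, TensorProduct.comm_tmul, TensorProduct.comm_tmul,
        TensorProduct.comm_tmul, Algebra.TensorProduct.tmul_mul_tmul]

theorem tensorFst_comm (a : (E.kerCM 0).Tensor (E.kerCM 1)) :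
    (E.kerCM 1).tensorFst (E.kerCM 0) (TensorProduct.comm (E _⦋1⦌) (E.kerD 0) (E.kerD 1) a)
      = (E.kerCM 0).tensorSnd (E.kerCM 1) a := by
  induction a using TensorProduct.induction_on with
  | zero => simp only [map_zero]
  | add a a' ha ha' => rw [map_add, map_add, ha, ha', map_add]
  | tmul z x => rfl

theorem tensorSnd_comm (a : (E.kerCM 0).Tensor (E.kerCM 1)) :
    (E.kerCM 1).tensorSnd (E.kerCM 0) (TensorProduct.comm (E _⦋1⦌) (E.kerD 0) (E.kerD 1) a)
      = (E.kerCM 0).tensorFst (E.kerCM 1) a := by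
  induction a using TensorProduct.induction_on with
  | zero => simp only [map_zero]
  | add a a' ha ha' => rw [map_add, map_add, ha, ha', map_add]
  | tmul z x => rfl

end SimpAlg

theorem corollary5p2 {k : Type u} [CommRing k] {F E : SimpAlg.{u, v} k} (hF : F.IsFree)
    (ι : E ⟶ F) (hι : SimpAlg.IsSkeleton 1 ι) :
    ∃ (Φ : (E.kerCM 1).Tensor (E.kerCM 0) ≃ₗ[E _⦋1⦌] E.TopCorner)
      (Ψ : (E.kerCM 0).Tensor (E.kerCM 1) ≃ₗ[E _⦋1⦌] E.TopCorner),
      (∀ a b, Φ (a * b) = Φ a * Φ b) ∧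
      (∀ a b, Ψ (a * b) = Ψ a * Ψ b) ∧
      (∀ x y : E.kerD 0, Φ (E.bar y ⊗ₜ[E _⦋1⦌] x) = SimpAlg.TopCorner.mk E (E.hElt x y)) ∧
      (∀ x y : E.kerD 0, Ψ (x ⊗ₜ[E _⦋1⦌] E.bar y) = SimpAlg.TopCorner.mk E (E.hElt x y)) ∧
      (∀ a, E.topBd 1 (Φ a) = (E.kerCM 1).tensorFst (E.kerCM 0) a) ∧
      (∀ a, E.topBd 0 (Φ a) = (E.kerCM 1).tensorSnd (E.kerCM 0) a) ∧
      (∀ a, E.topBd 0 (Ψ a) = (E.kerCM 0).tensorFst (E.kerCM 1) a) ∧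
      (∀ a, E.topBd 1 (Ψ a) = (E.kerCM 0).tensorSnd (E.kerCM 1) a) := by
  obtain ⟨B, β, h⟩ := hι.exists_isOneFree hF
  let Φ := LinearEquiv.ofBijective E.tensorToTop
    ⟨h.tensorToTop_injective, h.tensorToTop_surjective⟩
  refine ⟨Φ, (TensorProduct.comm (E _⦋1⦌) (E.kerD 0) (E.kerD 1)).trans Φ, E.tensorToTop_mul,
    fun a b => ?_, fun x y => E.topPairing_bar x y, fun x y => E.topPairing_bar x y,
    E.topBd_one_tensorToTop, E.topBd_zero_tensorToTop, fun a => ?_, fun a => ?_⟩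
  · exact (congrArg Φ (SimpAlg.kerCM_comm_mul a b)).trans (E.tensorToTop_mul _ _)
  · exact (E.topBd_zero_tensorToTop _).trans (SimpAlg.tensorSnd_comm a)
  · exact (E.topBd_one_tensorToTop _).trans (SimpAlg.tensorFst_comm a)
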